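/- Lemma lem:greenblackarm (Green-Black Arm Lemma). Work in the hyperbolic plane $\mathbb{H}^2$ (curvature $-1$); $|XY|$ denotes hyperbolic distance. Definitions. A bounded convex hyperbolic polygon is given by its distinct vertices $q_1,\dots,q_m$ ($m\ge 3$, not all collinear), listed in counterclockwise order along the boundary of a compact convex region (interior angles equal to $\pi$ are allowed, i.e. sides may be subdivided). A relaxed green-black polygon is such a polygon whose edges are each colored green or black, such that each green edge is adjacent to two black edges and makes with them interior angles at most $\pi/2$; a vertex is colored black if it is incident to a green edge, and green otherwise. A green-black arm chain is a chain of consecutive edges of a relaxed green-black polygon that begins and ends with a black edge, has at least one edge, and has two distinct endpoints (the free vertices); it is determined by the list $p_1,\dots,p_n$ ($n\ge 2$) of its vertices in order, and $\angle p_i$ denotes its angle $\angle p_{i-1}p_ip_{i+1}\in[0,\pi]$ at the interior vertex $p_i$, $1<i<n$. Two green-black arm chains are compatible if they have the same number of edges and the sequences of edge colors agree; they are black-edge congruent if, moreover, corresponding black edges have equal lengths. Statement. Let $p_1,\dots,p_n$ and $p_1',\dots,p_n'$ determine two compatible, black-edge congruent green-black arm chains $P$ and $P'$ such that: 1. if the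 edge $p_ip_{i+1}$ is green, then $|p_ip_{i+1}|\le |p_i'p_{i+1}'|$; 2. for $1<i<n$, if $p_i$ is green, then $\angle p_i\le\angle p_i'$, and if $p_i$ is black, then $\angle p_i=\angle p_i'$; 3. if the edge $p_ip_{i+1}$ is green, then $\angle p_i=\pi/2$. Then $|p_1p_n|\le|p_1'p_n'|$, with equality if and only if $|p_ip_{i+1}|=|p_i'p_{i+1}'|$ for all $1\le i<n$ and $\angle p_i=\angle p_i'$ for all $1<i<n$. -/

import Mathlib

/-!
The hyperbolic plane is the upper half-plane `UpperHalfPlane` with its Mathlib metric,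
which is the hyperbolic metric of curvature `-1`.
-/

noncomputable section

/-- The Cayley transform `z ↦ (z - p) / (z - p̄)`, evaluated at `q`.  It is a holomorphic (hence
conformal and orientation preserving) isometry of the upper half-plane onto the Poincaré disc that
sends `p` to `0`, and the geodesic rays that start at `p` to the straight radii of the disc.
So for `q ≠ p` the complex number `hypDir p q`, as a vector, represents the initial direction of the
geodesic segment from `p` to `q`. -/
def hypDir (p q : UpperHalfPlane) : ℂ :=
  ((q : ℂ) - (p : ℂ)) / ((q : ℂ) - (starRingEnd ℂ) (p : ℂ))

/-- The hyperbolic angle `∠ a b c`, in `[0, π]`, at `b` between the geodesic segments `ba` and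
`bc` (meaningful for `a ≠ b` and `c ≠ b`). -/
def hypAngle (a b c : UpperHalfPlane) : ℝ :=
  InnerProductGeometry.angle (hypDir b a) (hypDir b c)

/-- The orientation of a hyperbolic triangle.  For `p ≠ q` it is positive, zero or negative
according as `r` lies to the left of, on, or to the right of the geodesic line through `p` and `q`,
directed from `p` to `q`; so it is positive when `p, q, r` are the vertices of a nondegenerate
triangle in counterclockwise order. -/
def hypOrient (p q r : UpperHalfPlane) : ℝ :=
  ((starRingEnd ℂ) (hypDir p q) * hypDir p r).im

/-- The closed polygon with the cyclically indexed vertices `v 0, …, v (m - 1)` is a (bounded)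
convex hyperbolic polygon with its vertices listed in counterclockwise order: the vertices are
distinct, any three of them, taken in their cyclic order, are in counterclockwise order or
collinear, and they are not all collinear.  Interior angles equal to `π` are allowed, that is, a
side may be subdivided by vertices. -/
structure IsConvexHypPolygon (m : ℕ) (v : ZMod m → UpperHalfPlane) : Prop where
  three_le : 3 ≤ m
  injective : Function.Injective v
  orient_nonneg : ∀ i j k : ZMod m, i.val < j.val → j.val < k.val →
    0 ≤ hypOrient (v i) (v j) (v k)
  nondegenerate : ∃ i j k : ZMod m, hypOrient (v i) (v j) (v k) ≠ 0

/-- The two colors of edges and vertices. -/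
inductive GBColor : Type
  | green : GBColor
  | black : GBColor

/-- A relaxed green-black polygon with `m` vertices: a bounded convex hyperbolic polygon with
colored edges (edge `i` joins vertex `i` to vertex `i + 1`, indices being cyclic), such that each
green edge is adjacent to two black edges, with which it makes interior angles of at most `π / 2`.
(The vertices incident to a green edge are black, the others are green; the color of a vertex is
thus determined by those of the edges.) -/
structure RelaxedGreenBlackPolygon (m : ℕ) where
  vertex : ZMod m → UpperHalfPlane
  edgeColor : ZMod m → GBColor
  convex : IsConvexHypPolygon m vertex
  prev_black : ∀ i, edgeColor i = GBColor.green → edgeColor (i - 1) = GBColor.black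
  next_black : ∀ i, edgeColor i = GBColor.green → edgeColor (i + 1) = GBColor.black
  angle_left : ∀ i, edgeColor i = GBColor.green →
    hypAngle (vertex (i - 1)) (vertex i) (vertex (i + 1)) ≤ Real.pi / 2
  angle_right : ∀ i, edgeColor i = GBColor.green →
    hypAngle (vertex i) (vertex (i + 1)) (vertex (i + 2)) ≤ Real.pi / 2

/-- A green-black arm chain with `k + 1` edges, `k + 2` vertices and `k` interior vertices: a
subchain of consecutive edges of a relaxed green-black polygon that begins and ends with black
edges.  Edge `i` joins vertex `i` to vertex `i + 1`; the vertices `0` and `k + 1` are the free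
vertices, and they are distinct, the chain being a proper part of the polygon. -/
structure GreenBlackArmChain (k : ℕ) where
  vertex : Fin (k + 2) → UpperHalfPlane
  edgeColor : Fin (k + 1) → GBColor
  isSubchain : ∃ (m : ℕ) (Q : RelaxedGreenBlackPolygon m) (s : ZMod m), k + 2 ≤ m ∧
    (∀ i : Fin (k + 2), vertex i = Q.vertex (s + ((i : ℕ) : ZMod m))) ∧
    (∀ i : Fin (k + 1), edgeColor i = Q.edgeColor (s + ((i : ℕ) : ZMod m)))
  first_black : edgeColor 0 = GBColor.black
  last_black : edgeColor (Fin.last k) = GBColor.black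

namespace GreenBlackArmChain

/-- The hyperbolic length of edge `i`. -/
def edgeLength {k : ℕ} (P : GreenBlackArmChain k) (i : Fin (k + 1)) : ℝ :=
  dist (P.vertex i.castSucc) (P.vertex i.succ)

/-- The angle of the chain at its interior vertex number `j`, that is, at vertex `j + 1`, which is
incident to the edges `j` and `j + 1`. -/
def angle {k : ℕ} (P : GreenBlackArmChain k) (j : Fin k) : ℝ :=
  hypAngle (P.vertex j.castSucc.castSucc) (P.vertex j.succ.castSucc) (P.vertex j.succ.succ)

/-- The interior vertex number `j` is green: both edges incident to it are black. -/
def IsGreenVertex {k : ℕ} (P : GreenBlackArmChain k) (j : Fin k) : Prop :=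
  P.edgeColor j.castSucc = GBColor.black ∧ P.edgeColor j.succ = GBColor.black

/-- The distance between the two free vertices. -/
def freeDist {k : ℕ} (P : GreenBlackArmChain k) : ℝ :=
  dist (P.vertex 0) (P.vertex (Fin.last (k + 1)))

/-- Two chains with the same number of edges are compatible: the colors of their edges come in the
same order. -/
def Compatible {k : ℕ} (P P' : GreenBlackArmChain k) : Prop :=
  ∀ i, P.edgeColor i = P'.edgeColor i

/-- Compatible, and corresponding black edges have the same length. -/
def BlackEdgeCongruent {k : ℕ} (P P' : GreenBlackArmChain k) : Prop :=
  P.Compatible P' ∧ ∀ i, P.edgeColor i = GBColor.black → P.edgeLength i = P'.edgeLength i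

end GreenBlackArmChain

end

/-! The proof is Cauchy's arm lemma by a split at the highest vertex, carried out on the
hyperboloid, where the Lorentz product of two points is the hyperbolic cosine of their distance. A
convex chain is described by its edge lengths and its left turns (π minus the interior angles), so
opening the chain means decreasing turns. A green edge may also grow, but only between two turns of
at least π/2 and between two edges of fixed length.

Take a vertex farthest from the line through the free vertices, move it to the base point, and make
the second axis the perpendicular from it to that line. Convexity makes both arms descend from this
vertex: along every edge the foot of the perpendicular to the axis moves towards the line
(`descends_of_convex`). The turn at the top is divided between the two arms.

For one arm, the signed distance of its free end from the axis does not decrease (`dot_endpt_le`).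
This is an induction along the arm with the distance function carried in a moving frame. Decreasing
a turn rotates the tail towards the gradient, through angles within [0, π], where cosine decreases;
lengthening an edge between two obtuse turns moves the tail away from the axis
(`dot_boost_le_of_obtuse`).

Originally the free ends lie on a common perpendicular to the axis, so their distance is the sum of
their signed distances from it, each measured towards its own side; after opening it is at least the
new sum (`bil_arms_le`). Equality forces all data to agree, except perhaps the length of a first
edge that lies on the axis. Growth of such an edge pushes the foot of its free end strictly past the
line. The two feet then differ, unless both first edges grow; but these are adjacent, and neighbours
of a growing edge are fixed. -/

noncomputable section

/-! ### Minkowski space and the hyperboloid -/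

/-- A vector of the three-dimensional Minkowski space. -/
@[ext]
structure LVec where
  t : ℝ
  x : ℝ
  y : ℝ

namespace LVec

/-- The Lorentz form of signature `(+, -, -)`. -/
def bil (u v : LVec) : ℝ := u.t * v.t - u.x * v.x - u.y * v.y

/-- The determinant of three vectors. -/
def det (u v w : LVec) : ℝ :=
  u.t * (v.x * w.y - v.y * w.x) - u.x * (v.t * w.y - v.y * w.t) + u.y * (v.t * w.x - v.x * w.t)

/-- The coordinatewise pairing. -/
def dot (u v : LVec) : ℝ := u.t * v.t + u.x * v.x + u.y * v.y

/-- The base point of the hyperboloid. -/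
def origin : LVec := ⟨1, 0, 0⟩

/-- The rotation about the base point. -/
def rot (a : ℝ) (v : LVec) : LVec :=
  ⟨v.t, Real.cos a * v.x - Real.sin a * v.y, Real.sin a * v.x + Real.cos a * v.y⟩

/-- The translation along the first axis. -/
def boost (l : ℝ) (v : LVec) : LVec :=
  ⟨Real.cosh l * v.t + Real.sinh l * v.x, Real.sinh l * v.t + Real.cosh l * v.x, v.y⟩

/-- The reflection in the second axis. -/
def mirror (v : LVec) : LVec := ⟨v.t, -v.x, v.y⟩

/-- The vector lies on the upper sheet of the hyperboloid. -/
def OnSheet (v : LVec) : Prop := 0 < v.t ∧ bil v v = 1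

/-- Coordinates in the orthonormal frame at `p` whose first axis points to the point `q` at
distance `l`. -/
def coord (p q : LVec) (l : ℝ) (v : LVec) : LVec :=
  ⟨bil p v, (Real.cosh l * bil p v - bil q v) / Real.sinh l, det p q v / Real.sinh l⟩

/-- The broken geodesic `p q r` with edges of lengths `l`, `l'` turns left by the angle `a`. -/
def Turn (p q r : LVec) (l l' a : ℝ) : Prop :=
  Real.sinh l * Real.sinh l' * Real.cos a = bil p r - Real.cosh l * Real.cosh l' ∧
    Real.sinh l * Real.sinh l' * Real.sin a = det p q r

theorem bil_comm (u v : LVec) : bil u v = bil v u := by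
  simp only [bil]; ring

theorem det_rotate (u v w : LVec) : det u v w = det v w u := by
  simp only [det]; ring

theorem det_swap (u v w : LVec) : det u v w = -det v u w := by
  simp only [det]; ring

theorem det_mul_det (a b c d e f : LVec) :
    det a b c * det d e f =
      bil a d * (bil b e * bil c f - bil b f * bil c e)
        - bil a e * (bil b d * bil c f - bil b f * bil c d)
        + bil a f * (bil b d * bil c e - bil b e * bil c d) := by
  simp only [det, bil]; ring

theorem bil_rot (a : ℝ) (u v : LVec) : bil (rot a u) (rot a v) = bil u v := by
  simp only [bil, rot]
  linear_combination (-u.x * v.x - u.y * v.y) * Real.sin_sq_add_cos_sq a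

theorem det_rot (a : ℝ) (u v w : LVec) : det (rot a u) (rot a v) (rot a w) = det u v w := by
  have h := Real.sin_sq_add_cos_sq a
  simp only [det, rot]
  linear_combination (u.t * (v.x * w.y - v.y * w.x) - u.x * (v.t * w.y - v.y * w.t)
    + u.y * (v.t * w.x - v.x * w.t)) * h

theorem bil_boost (l : ℝ) (u v : LVec) : bil (boost l u) (boost l v) = bil u v := by
  simp only [bil, boost]
  linear_combination (u.t * v.t - u.x * v.x) * Real.cosh_sq_sub_sinh_sq l

theorem bil_mirror (u v : LVec) : bil (mirror u) (mirror v) = bil u v := by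
  simp only [bil, mirror]; ring

theorem det_mirror (u v w : LVec) : det (mirror u) (mirror v) (mirror w) = -det u v w := by
  simp only [det, mirror]; ring

theorem OnSheet.sq {v : LVec} (h : OnSheet v) : v.t ^ 2 = 1 + v.x ^ 2 + v.y ^ 2 := by
  have := h.2; simp only [bil] at this; linarith

theorem OnSheet.one_le {v : LVec} (h : OnSheet v) : 1 ≤ v.t := by
  nlinarith [h.sq, h.1, sq_nonneg v.x, sq_nonneg v.y]

theorem OnSheet.abs_x_lt {v : LVec} (h : OnSheet v) : |v.x| < v.t :=
  abs_lt_of_sq_lt_sq (by nlinarith [h.sq, sq_nonneg v.y]) h.1.le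

theorem onSheet_origin : OnSheet origin := by
  simp [OnSheet, origin, bil]

theorem OnSheet.rot {v : LVec} (h : OnSheet v) (a : ℝ) : OnSheet (rot a v) :=
  ⟨h.1, by rw [bil_rot]; exact h.2⟩

theorem OnSheet.mirror {v : LVec} (h : OnSheet v) : OnSheet (mirror v) :=
  ⟨h.1, by rw [bil_mirror]; exact h.2⟩

theorem OnSheet.boost {v : LVec} (h : OnSheet v) (l : ℝ) : OnSheet (boost l v) := by
  refine ⟨?_, by rw [bil_boost]; exact h.2⟩
  have h1 := h.abs_x_lt
  have h2 : |Real.sinh l| < Real.cosh l :=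
    abs_lt_of_sq_lt_sq (by rw [Real.cosh_sq]; linarith) (Real.cosh_pos l).le
  have h3 : |Real.sinh l * v.x| < Real.cosh l * v.t := by
    rw [abs_mul]
    exact mul_lt_mul'' h2 h1 (abs_nonneg _) (abs_nonneg _)
  have := (abs_lt.1 h3).1
  simp only [LVec.boost]; linarith

/-- The reversed Cauchy-Schwarz inequality. -/
theorem OnSheet.one_le_bil {u v : LVec} (hu : OnSheet u) (hv : OnSheet v) : 1 ≤ bil u v := by
  have h1 := hu.sq
  have h2 := hv.sq
  have h3 : (1 + (u.x * v.x + u.y * v.y)) ^ 2 ≤ (u.t * v.t) ^ 2 := by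
    rw [mul_pow, h1, h2]
    nlinarith [sq_nonneg (u.x - v.x), sq_nonneg (u.y - v.y), sq_nonneg (u.x * v.y - u.y * v.x)]
  have := abs_le_of_sq_le_sq' h3 (mul_pos hu.1 hv.1).le
  simp only [bil]; linarith

theorem OnSheet.eq_of_bil_eq_one {u v : LVec} (hu : OnSheet u) (hv : OnSheet v)
    (h : bil u v = 1) : u = v := by
  have h1 := hu.sq
  have h2 := hv.sq
  have h3 : (1 + (u.x * v.x + u.y * v.y)) ^ 2 = (u.t * v.t) ^ 2 := by
    simp only [bil] at h
    congr 1; linarith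
  rw [mul_pow, h1, h2] at h3
  have hx : u.x = v.x := by
    nlinarith [sq_nonneg (u.x - v.x), sq_nonneg (u.y - v.y), sq_nonneg (u.x * v.y - u.y * v.x)]
  have hy : u.y = v.y := by
    nlinarith [sq_nonneg (u.x - v.x), sq_nonneg (u.y - v.y), sq_nonneg (u.x * v.y - u.y * v.x)]
  have ht : u.t = v.t := by
    have : u.t ^ 2 = v.t ^ 2 := by rw [h1, h2, hx, hy]
    exact (pow_left_inj₀ hu.1.le hv.1.le two_ne_zero).1 this
  exact LVec.ext ht hx hy

/-! ### Orthonormal frames along a broken geodesic -/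

section Coord

variable {p q r : LVec} {l l' a : ℝ}

theorem bil_coord (hp : OnSheet p) (hq : OnSheet q) (hl : 0 < l) (h : bil p q = Real.cosh l)
    (u v : LVec) : bil (coord p q l u) (coord p q l v) = bil u v := by
  have hs := (Real.sinh_pos_iff.2 hl).ne'
  have hd := det_mul_det p q u p q v
  rw [hp.2, hq.2, bil_comm q p, h, bil_comm u p, bil_comm u q] at hd
  have hc := Real.cosh_sq l
  rw [show bil (coord p q l u) (coord p q l v) = bil p u * bil p v -
    (Real.cosh l * bil p u - bil q u) / Real.sinh l * ((Real.cosh l * bil p v - bil q v)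
    / Real.sinh l) - det p q u / Real.sinh l * (det p q v / Real.sinh l) from rfl]
  field_simp
  rw [hd]
  linear_combination (-bil p u * bil p v + bil u v) * hc

theorem det_coord (hp : OnSheet p) (hq : OnSheet q) (hl : 0 < l) (h : bil p q = Real.cosh l)
    (u v w : LVec) : det (coord p q l u) (coord p q l v) (coord p q l w) = det u v w := by
  have hs := (Real.sinh_pos_iff.2 hl).ne'
  have hc := Real.cosh_sq l
  have key : ∀ c : ℝ, det ⟨bil p u, c * bil p u - bil q u, det p q u⟩
      ⟨bil p v, c * bil p v - bil q v, det p q v⟩ ⟨bil p w, c * bil p w - bil q w, det p q w⟩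
      = (bil p q ^ 2 - bil p p * bil q q) * det u v w := by
    intro c
    simp only [det, bil]; ring
  have h1 := key (Real.cosh l)
  rw [hp.2, hq.2, h] at h1
  have : det (coord p q l u) (coord p q l v) (coord p q l w) * Real.sinh l ^ 2
      = det ⟨bil p u, Real.cosh l * bil p u - bil q u, det p q u⟩
      ⟨bil p v, Real.cosh l * bil p v - bil q v, det p q v⟩
      ⟨bil p w, Real.cosh l * bil p w - bil q w, det p q w⟩ := by
    rw [coord, coord, coord]
    generalize det p q u = du
    generalize det p q v = dv
    generalize det p q w = dw
    simp only [det]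
    field_simp
  rw [h1, hc] at this
  have h2 : Real.sinh l ^ 2 ≠ 0 := pow_ne_zero _ hs
  apply mul_right_cancel₀ h2
  rw [this]; ring

/-- The frame at `q` arises from the frame at `p` by advancing by `l` and turning left by `a`;
coordinates transform back by a rotation followed by a boost. The two equations in `Turn` give the
cosine and sine of this rotation. -/
theorem coord_eq_boost_rot (hq : OnSheet q) (hr : OnSheet r) (hl : 0 < l)
    (hl' : 0 < l') (h : bil p q = Real.cosh l) (h' : bil q r = Real.cosh l')
    (ht : Turn p q r l l' a) (v : LVec) :
    coord p q l v = boost l (rot a (coord q r l' v)) := by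
  have hs := (Real.sinh_pos_iff.2 hl).ne'
  have hs' := (Real.sinh_pos_iff.2 hl').ne'
  have hc := Real.cosh_sq l
  have hc' := Real.cosh_sq l'
  obtain ⟨t1, t2⟩ := ht
  have e1 : (bil p v * bil q q - bil p q * bil q v) * (bil q r ^ 2 - bil q q * bil r r)
      = (bil p r * bil q q - bil p q * bil q r) * (bil q r * bil q v - bil q q * bil r v)
        - bil q q * (det p q r * det q r v) := by
    rw [det_mul_det, bil_comm r q]; ring
  have e2 : det p q v * (bil q r ^ 2 - bil q q * bil r r)
      = det p q r * (bil q r * bil q v - bil q q * bil r v)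
        + (bil p r * bil q q - bil p q * bil q r) * det q r v := by
    simp only [det, bil]; ring
  rw [hq.2, hr.2, h, h', hc'] at e1 e2
  have ca : Real.cos a = (bil p r - Real.cosh l * Real.cosh l') / (Real.sinh l * Real.sinh l') := by
    rw [← t1]; field_simp
  have sa : Real.sin a = det p q r / (Real.sinh l * Real.sinh l') := by
    rw [← t2]; field_simp
  have k1 : Real.cos a * (coord q r l' v).x - Real.sin a * (coord q r l' v).y
      = (bil p v - Real.cosh l * bil q v) / Real.sinh l := by
    rw [ca, sa]
    simp only [coord]
    field_simp
    linear_combination -e1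
  have k2 : Real.sin a * (coord q r l' v).x + Real.cos a * (coord q r l' v).y
      = det p q v / Real.sinh l := by
    rw [ca, sa]
    simp only [coord]
    field_simp
    linear_combination -e2
  have k3 : (coord q r l' v).t = bil q v := rfl
  rw [rot, boost, k1, k2, k3]
  ext
  · simp only [coord]
    field_simp
    ring
  · simp only [coord]
    field_simp
    linear_combination (bil q v) * hc
  · rfl

end Coord

/-! ### Signed distance from a geodesic, seen from a moving frame -/

theorem exists_polar (x y : ℝ) (hy : 0 ≤ y) :
    ∃ R ζ : ℝ, 0 ≤ R ∧ 0 ≤ ζ ∧ ζ ≤ Real.pi ∧ x = R * Real.cos ζ ∧ y = R * Real.sin ζ := by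
  refine ⟨‖(⟨x, y⟩ : ℂ)‖, Complex.arg ⟨x, y⟩, norm_nonneg _, Complex.arg_nonneg_iff.2 hy,
    Complex.arg_le_pi _, ?_, ?_⟩
  · rw [Complex.norm_mul_cos_arg]
  · rw [Complex.norm_mul_sin_arg]

theorem le_pi_of_sin_nonneg {s : ℝ} (h2 : s < 2 * Real.pi) (hs : 0 ≤ Real.sin s) :
    s ≤ Real.pi := by
  by_contra! h
  have : 0 < Real.sin (s - Real.pi) := Real.sin_pos_of_pos_of_lt_pi (by linarith) (by linarith)
  rw [Real.sin_sub_pi] at this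
  linarith

theorem dot_boost (l : ℝ) (u v : LVec) : dot (boost l u) v = dot u (boost l v) := by
  simp only [dot, boost]; ring

theorem dot_rot_neg (a : ℝ) (u v : LVec) : dot (rot (-a) u) v = dot u (rot a v) := by
  simp only [dot, rot, Real.cos_neg, Real.sin_neg]; ring

/-- The covector is the unit normal of a geodesic. -/
def IsUnitCovec (n : LVec) : Prop := n.x ^ 2 + n.y ^ 2 = 1 + n.t ^ 2

theorem IsUnitCovec.rot {n : LVec} (h : IsUnitCovec n) (a : ℝ) : IsUnitCovec (rot a n) := by
  unfold IsUnitCovec at *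
  simp only [LVec.rot]
  linear_combination h + (n.x ^ 2 + n.y ^ 2) * Real.sin_sq_add_cos_sq a

theorem IsUnitCovec.boost {n : LVec} (h : IsUnitCovec n) (l : ℝ) : IsUnitCovec (boost l n) := by
  unfold IsUnitCovec at *
  simp only [LVec.boost]
  linear_combination h + (n.x ^ 2 - n.t ^ 2) * Real.cosh_sq_sub_sinh_sq l

/-- The covector is Lorentz dual to a vector of square -1. The expression is the time coordinate of
the orthogonal projection of `v` to the plane of the geodesic `n = 0`, and this projection is
timelike and future-directed. -/
theorem IsUnitCovec.proj_pos {n v : LVec} (hn : IsUnitCovec n) (hv : OnSheet v) :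
    0 < v.t + n.t * dot n v := by
  have h1 := hv.sq
  have h2 : (n.x * v.x + n.y * v.y) ^ 2 ≤ (1 + n.t ^ 2) * (v.t ^ 2 - 1) := by
    rw [← hn, h1]
    nlinarith [sq_nonneg (n.x * v.y - n.y * v.x)]
  have h3 : (n.t * (n.x * v.x + n.y * v.y)) ^ 2 < ((1 + n.t ^ 2) * v.t) ^ 2 := by
    have h4 : (n.t * (n.x * v.x + n.y * v.y)) ^ 2 ≤ n.t ^ 2 * ((1 + n.t ^ 2) * (v.t ^ 2 - 1)) := by
      rw [mul_pow]; exact mul_le_mul_of_nonneg_left h2 (sq_nonneg _)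
    have h5 := hv.1
    have : 0 < v.t ^ 2 := by positivity
    have : ((1 + n.t ^ 2) * v.t) ^ 2 - n.t ^ 2 * ((1 + n.t ^ 2) * (v.t ^ 2 - 1))
      = (1 + n.t ^ 2) * (v.t ^ 2 + n.t ^ 2) := by ring
    have : 0 < (1 + n.t ^ 2) * (v.t ^ 2 + n.t ^ 2) := by positivity
    linarith
  have h6 := abs_lt_of_sq_lt_sq h3 (mul_pos (by positivity) hv.1).le
  have h7 := (abs_lt.1 h6).1
  simp only [dot]
  linarith

theorem IsUnitCovec.boost_x_neg {n : LVec} (h : IsUnitCovec n) (hy : n.y = 0) (hx : n.x < 0)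
    (l : ℝ) : (LVec.boost l n).x < 0 := by
  have h1 : n.t ^ 2 < (-n.x) ^ 2 := by
    unfold IsUnitCovec at h
    rw [hy] at h; linarith
  have h2 : |n.t| < -n.x := abs_lt_of_sq_lt_sq h1 (by linarith)
  have h3 : |Real.sinh l| < Real.cosh l :=
    abs_lt_of_sq_lt_sq (by rw [Real.cosh_sq]; linarith) (Real.cosh_pos l).le
  have h4 : |Real.sinh l * n.t| < Real.cosh l * -n.x := by
    rw [abs_mul]; exact mul_lt_mul'' h3 h2 (abs_nonneg _) (abs_nonneg _)
  have := (abs_lt.1 h4).2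
  simp only [LVec.boost]; linarith

/-- A covector descends with slope `s` at the base point, relative to the first axis. -/
def HasSlope (n : LVec) (s : ℝ) : Prop :=
  ∃ ρ : ℝ, 0 < ρ ∧ n.x = ρ * Real.cos s ∧ n.y = -(ρ * Real.sin s)

theorem HasSlope.rot {n : LVec} {s : ℝ} (h : HasSlope n s) (a : ℝ) :
    HasSlope (rot (-a) n) (s + a) := by
  obtain ⟨ρ, h0, hx, hy⟩ := h
  refine ⟨ρ, h0, ?_, ?_⟩
  · simp only [LVec.rot, hx, hy, Real.cos_neg, Real.sin_neg, Real.cos_add]; ring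
  · simp only [LVec.rot, hx, hy, Real.cos_neg, Real.sin_neg, Real.sin_add]; ring

/-- Advancing along the first axis preserves the second coordinate of the covector, so the sine of
the slope keeps its sign. The new slope could be 0 only if `n.y = 0`, hence `s = π`; but then the
covector points backward and, by `boost_x_neg`, continues to do so. -/
theorem HasSlope.boost {n : LVec} {s : ℝ} (h : HasSlope n s) (hn : IsUnitCovec n) (h0 : 0 < s)
    (hpi : s ≤ Real.pi) (l : ℝ) :
    ∃ s' : ℝ, 0 < s' ∧ s' ≤ Real.pi ∧ HasSlope (boost l n) s' := by
  obtain ⟨ρ, hρ, hx, hy⟩ := h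
  have hs : 0 ≤ ρ * Real.sin s := mul_nonneg hρ.le (Real.sin_nonneg_of_nonneg_of_le_pi h0.le hpi)
  have hy' : (LVec.boost l n).y = n.y := rfl
  obtain ⟨R, ζ, hR, hζ, hζpi, ex, ey⟩ := exists_polar (LVec.boost l n).x (-(LVec.boost l n).y)
    (by rw [hy', hy]; linarith)
  have hR' : R ≠ 0 := by
    rintro rfl
    have := hn.boost l
    unfold IsUnitCovec at this
    rw [ex, show (LVec.boost l n).y = 0 by linarith] at this
    nlinarith [sq_nonneg (LVec.boost l n).t]
  have hR0 : 0 < R := lt_of_le_of_ne hR hR'.symm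
  refine ⟨ζ, lt_of_le_of_ne hζ ?_, hζpi, R, hR0, ex, by linarith⟩
  rintro rfl
  rw [Real.sin_zero, mul_zero] at ey
  rw [Real.cos_zero, mul_one] at ex
  have hny : n.y = 0 := by rw [← hy']; linarith
  have hsin : Real.sin s = 0 := by
    have : ρ * Real.sin s = 0 := by linarith
    exact (mul_eq_zero.1 this).resolve_left hρ.ne'
  have hspi : s = Real.pi := by
    by_contra hne
    exact (Real.sin_pos_of_pos_of_lt_pi h0 (lt_of_le_of_ne hpi hne)).ne' hsin
  have hnx : n.x < 0 := by rw [hx, hspi, Real.cos_pi]; linarith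
  have := hn.boost_x_neg hny hnx l
  linarith

/-- Heights are compared through perpendicular feet on the geodesic `o = 0`. The point `v` is below
the far end of the edge by `hS`, and the far end is below the near end because `o.y ≤ 0`; so `v` is
below the near end. The identity `id` expresses this transitivity, with weights that are positive by
`proj_pos`. -/
theorem lower_of_lower {o v : LVec} {l : ℝ} (ho : IsUnitCovec o) (hv : OnSheet v) (hl : 0 ≤ l)
    (hy : o.y ≤ 0) (hS : 0 ≤ (boost l o).x * v.y - (boost l o).y * v.x) :
    0 ≤ o.x * v.y - o.y * (boost l v).x := by
  have hc := Real.cosh_sq_sub_sinh_sq l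
  have h1 := (ho.boost l).proj_pos hv
  have h2 := ho.proj_pos (onSheet_origin.boost l)
  have hsh := Real.sinh_nonneg_iff.2 hl
  have id : (o.x * v.y - o.y * (boost l v).x) * (1 + (boost l o).t ^ 2)
      = ((boost l o).x * v.y - (boost l o).y * v.x)
          * ((boost l origin).t + o.t * dot o (boost l origin))
        + Real.sinh l * -o.y * (v.t + (boost l o).t * dot (boost l o) v) := by
    have hN := ho.boost l
    unfold IsUnitCovec at hN
    have e1 : o.x = Real.cosh l * (boost l o).x - Real.sinh l * (boost l o).t := by
      simp only [boost]; linear_combination (-o.x) * hc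
    have e2 : o.t = Real.cosh l * (boost l o).t - Real.sinh l * (boost l o).x := by
      simp only [boost]; linear_combination (-o.t) * hc
    have e3 : o.y = (boost l o).y := rfl
    have e4 : dot o (boost l origin) = (boost l o).t := by simp [dot, boost, origin]; ring
    rw [e4, e1, e2, e3]
    generalize boost l o = N at hN
    simp only [dot, boost, origin]
    linear_combination (Real.sinh l * N.t * v.y) * hN
  have h3 : 0 < 1 + (boost l o).t ^ 2 := by positivity
  refine nonneg_of_mul_nonneg_left ?_ h3
  rw [id]
  exact add_nonneg (mul_nonneg hS h2.le) (mul_nonneg (mul_nonneg hsh (by linarith)) h1.le)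

/-- Lengthening an edge that makes acute angles with its neighbours moves the tail away. -/
theorem dot_boost_le_of_obtuse {o v : LVec} {l l' : ℝ} (ho : IsUnitCovec o) (hv : OnSheet v)
    (hl : 0 < l) (hll : l ≤ l') (hoy : o.y ≤ 0) (hot : 0 ≤ o.t ∨ o.x ≤ 0) (hNx : 0 ≤ (boost l o).x)
    (hvx : v.x ≤ 0) (hS : 0 ≤ (boost l o).x * v.y - (boost l o).y * v.x) :
    dot o (boost l v) ≤ dot o (boost l' v) ∧
      (dot o (boost l v) = dot o (boost l' v) → l = l' ∨ (o.t = 0 ∧ o.x = 0)) := by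
  have hN := ho.boost l
  have hsh := Real.sinh_pos_iff.2 hl
  have hch := Real.cosh_pos l
  have hc := Real.cosh_sq_sub_sinh_sq l
  set N := boost l o with hNdef
  have hNt : 0 ≤ N.t := by
    by_contra! hneg
    have e1 : o.x = Real.cosh l * N.x - Real.sinh l * N.t := by
      simp only [hNdef, boost]; linear_combination (-o.x) * hc
    have e2 : o.t = Real.cosh l * N.t - Real.sinh l * N.x := by
      simp only [hNdef, boost]; linear_combination (-o.t) * hc
    rcases hot with h | h
    · have := mul_pos hch (neg_pos.2 hneg)
      have := mul_nonneg hsh.le hNx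
      linarith
    · have := mul_pos hsh (neg_pos.2 hneg)
      have := mul_nonneg hch.le hNx
      linarith
  have hNy : N.y ≤ 0 := hoy
  have hvsq := hv.sq
  have hvt := hv.1
  have habs := (abs_lt.1 hv.abs_x_lt).1
  -- Square `hS` and eliminate both second coordinates by the normalizations of `N` and `v`. The
  -- resulting bound `hD` says that the growth rate at `δ = 0` is nonnegative.
  have hsq : (N.t * -v.x) ^ 2 + v.x ^ 2 + N.x ^ 2 ≤ (v.t * N.x) ^ 2 := by
    have h1 : (-N.y * -v.x) ^ 2 ≤ (N.x * v.y) ^ 2 :=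
      pow_le_pow_left₀ (mul_nonneg (by linarith) (by linarith)) (by linarith) 2
    unfold IsUnitCovec at hN
    have h2 : N.y ^ 2 = 1 + N.t ^ 2 - N.x ^ 2 := by linarith
    have h3 : v.y ^ 2 = v.t ^ 2 - v.x ^ 2 - 1 := by linarith
    have h4 : (1 + N.t ^ 2 - N.x ^ 2) * v.x ^ 2 ≤ N.x ^ 2 * (v.t ^ 2 - v.x ^ 2 - 1) := by
      rw [← h2, ← h3]; nlinarith
    nlinarith
  have hD : N.t * -v.x ≤ v.t * N.x := by
    refine abs_le_of_sq_le_sq' ?_ (mul_nonneg hvt.le hNx) |>.2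
    nlinarith [sq_nonneg v.x, sq_nonneg N.x]
  have hCD : 0 ≤ (N.t + N.x) * (v.t + v.x) := mul_nonneg (by linarith) (by linarith)
  obtain ⟨δ, rfl⟩ : ∃ δ, l' = l + δ := ⟨l' - l, by ring⟩
  have hδ : 0 ≤ δ := by linarith
  have hdiff : dot o (boost (l + δ) v) - dot o (boost l v)
      = (N.t * v.t + N.x * v.x) * (Real.cosh δ - 1) + (v.t * N.x + v.x * N.t) * Real.sinh δ := by
    simp only [hNdef, dot, boost, Real.cosh_add, Real.sinh_add]; ring
  -- Both coefficients are now nonnegative, and the last factor equals `1 - exp (-δ)`.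
  have hdiff' : dot o (boost (l + δ) v) - dot o (boost l v)
      = (N.t + N.x) * (v.t + v.x) * (Real.cosh δ - 1)
        + (v.t * N.x + v.x * N.t) * (Real.sinh δ - (Real.cosh δ - 1)) := by
    rw [hdiff]; ring
  have hcδ := Real.one_le_cosh δ
  have hsc : Real.cosh δ - 1 ≤ Real.sinh δ := by
    have h1 := Real.cosh_sub_sinh δ
    have h2 : Real.exp (-δ) ≤ 1 := Real.exp_le_one_iff.2 (by linarith)
    linarith
  constructor
  · have h1 := mul_nonneg hCD (sub_nonneg.2 hcδ)
    have h2 : 0 ≤ (v.t * N.x + v.x * N.t) * (Real.sinh δ - (Real.cosh δ - 1)) :=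
      mul_nonneg (by linarith) (by linarith)
    linarith
  · intro heq
    rcases hδ.eq_or_lt with h0 | hpos
    · left; linarith
    right
    have hcpos : 0 < Real.cosh δ - 1 := by
      have := Real.one_lt_cosh.2 hpos.ne'
      linarith
    have hspos : 0 < Real.sinh δ - (Real.cosh δ - 1) := by
      have h1 := Real.cosh_sub_sinh δ
      have h2 : Real.exp (-δ) < 1 := Real.exp_lt_one_iff.2 (by linarith)
      linarith
    have h1 := mul_nonneg hCD hcpos.le
    have hDn : 0 ≤ v.t * N.x + v.x * N.t := by linarith
    have h2 := mul_nonneg hDn hspos.le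
    -- Equality with a strictly longer edge makes the functional vanish along the whole line of the
    -- edge: the edge lies on the geodesic `o = 0`.
    have h3 : (N.t + N.x) * (v.t + v.x) * (Real.cosh δ - 1) = 0 := by linarith
    have h4 : (N.t + N.x) * (v.t + v.x) = 0 := (mul_eq_zero.1 h3).resolve_right hcpos.ne'
    have h5 : N.t + N.x = 0 := (mul_eq_zero.1 h4).resolve_right (by linarith)
    have hNt0 : N.t = 0 := by linarith
    have hNx0 : N.x = 0 := by linarith
    constructor
    · have : o.t = Real.cosh l * N.t - Real.sinh l * N.x := by
        simp only [hNdef, boost]; linear_combination (-o.t) * hc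
      rw [this, hNt0, hNx0]; ring
    · have : o.x = Real.cosh l * N.x - Real.sinh l * N.t := by
        simp only [hNdef, boost]; linear_combination (-o.x) * hc
      rw [this, hNt0, hNx0]; ring

/-! ### Monotonicity of a single arm -/

/-- The vector points, from the base point, in the direction at angle `s` to the first axis. -/
def HasArg (v : LVec) (s : ℝ) : Prop :=
  ∃ R : ℝ, 0 ≤ R ∧ v.x = R * Real.cos s ∧ v.y = R * Real.sin s

theorem HasArg.rot {v : LVec} {s : ℝ} (h : HasArg v s) (a : ℝ) : HasArg (rot a v) (a + s) := by
  obtain ⟨R, hR, hx, hy⟩ := h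
  refine ⟨R, hR, ?_, ?_⟩
  · simp only [LVec.rot, hx, hy, Real.cos_add]; ring
  · simp only [LVec.rot, hx, hy, Real.sin_add]; ring

/-- The endpoint of a broken geodesic with `r` edges that starts at the base point, with turning
angles `a` (the first one from the first axis) and edge lengths `l`. -/
def endpt : ℕ → (ℕ → ℝ) → (ℕ → ℝ) → LVec
  | 0, _, _ => origin
  | r + 1, a, l => rot (a 0) (boost (l 0) (endpt r (fun i => a (i + 1)) (fun i => l (i + 1))))

/-- The covector `n` in the moving frame of a broken geodesic. -/
def coframe : ℕ → (ℕ → ℝ) → (ℕ → ℝ) → LVec → LVec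
  | 0, _, _, n => n
  | r + 1, a, l, n =>
    coframe r (fun i => a (i + 1)) (fun i => l (i + 1)) (boost (l 0) (rot (-a 0) n))

theorem onSheet_endpt (r : ℕ) : ∀ a l : ℕ → ℝ, OnSheet (endpt r a l) := by
  induction r with
  | zero => exact fun _ _ => onSheet_origin
  | succ r ih => exact fun a l => ((ih _ _).boost _).rot _

/-- The effect of lengthening one edge. -/
theorem exists_hasArg_boost {o v : LVec} {l l' τ σ ζ : ℝ} (ho : IsUnitCovec o)
    (hτ0 : 0 < τ) (hτ : τ ≤ Real.pi) (hoτ : HasSlope o τ) (hσ0 : 0 < σ)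
    (hN : HasSlope (boost l o) σ) (hv : OnSheet v) (hvζ : HasArg v ζ) (hζ0 : 0 ≤ ζ)
    (hσζ : σ + ζ ≤ Real.pi) (hl : 0 < l) (hll : l ≤ l')
    (hg : l = l' ∨ (Real.pi / 2 ≤ ζ ∧ (0 ≤ o.t ∨ o.x ≤ 0))) :
    (∃ R β : ℝ, 0 < R ∧ 0 ≤ β ∧ τ + β ≤ Real.pi ∧ (boost l' v).x = R * Real.cos β ∧
        (boost l' v).y = R * Real.sin β) ∧
      dot o (boost l v) ≤ dot o (boost l' v) ∧
      (dot o (boost l v) = dot o (boost l' v) → l = l' ∨ (o.t = 0 ∧ o.x = 0)) := by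
  have hpi := Real.pi_pos
  obtain ⟨ρ, hρ, hox, hoy⟩ := hoτ
  obtain ⟨ρ', hρ', hNx, hNy⟩ := hN
  obtain ⟨R, hR, hvx, hvy⟩ := hvζ
  have hoy0 : o.y ≤ 0 := by
    rw [hoy]
    have := mul_nonneg hρ.le (Real.sin_nonneg_of_nonneg_of_le_pi hτ0.le hτ)
    linarith
  have hvy0 : 0 ≤ v.y := by
    rw [hvy]; exact mul_nonneg hR (Real.sin_nonneg_of_nonneg_of_le_pi hζ0 (by linarith))
  have hS : 0 ≤ (boost l o).x * v.y - (boost l o).y * v.x := by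
    have h1 := mul_nonneg (mul_nonneg hρ'.le hR)
      (Real.sin_nonneg_of_nonneg_of_le_pi (add_nonneg hσ0.le hζ0) hσζ)
    rw [Real.sin_add] at h1
    rw [hNx, hNy, hvx, hvy]; linarith
  have hmono : (boost l v).x ≤ (boost l' v).x := by
    have h1 := (abs_lt.1 hv.abs_x_lt).1
    obtain ⟨δ, rfl⟩ : ∃ δ, l' = l + δ := ⟨l' - l, by ring⟩
    have h2 := hv.boost l
    have h3 := (abs_lt.1 h2.abs_x_lt).1
    have h4 : (boost (l + δ) v).x
        = Real.sinh δ * (boost l v).t + Real.cosh δ * (boost l v).x := by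
      simp only [boost, Real.cosh_add, Real.sinh_add]; ring
    have hδ : 0 ≤ δ := by linarith
    have hcδ := Real.one_le_cosh δ
    have hsc : Real.cosh δ - 1 ≤ Real.sinh δ := by
      have h1 := Real.cosh_sub_sinh δ
      have h2 : Real.exp (-δ) ≤ 1 := Real.exp_le_one_iff.2 (by linarith)
      linarith
    rw [h4]
    nlinarith [mul_nonneg (sub_nonneg.2 hsc) h2.1.le,
      mul_nonneg (sub_nonneg.2 hcδ) (by linarith : 0 ≤ (boost l v).t + (boost l v).x)]
  have hX : 0 ≤ o.x * (boost l' v).y - o.y * (boost l' v).x := by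
    have h1 := lower_of_lower ho hv hl.le hoy0 hS
    have h2 := mul_le_mul_of_nonneg_left hmono (neg_nonneg.2 hoy0)
    have h3 : (boost l' v).y = v.y := rfl
    rw [h3]; linarith
  have hl' : 0 < l' := lt_of_lt_of_le hl hll
  constructor
  · obtain ⟨R', β, hR', hβ0, hβpi, ex, ey⟩ := exists_polar (boost l' v).x (boost l' v).y hvy0
    -- Since `σ > 0`, the bound `σ + ζ ≤ π` excludes `ζ = π`: the tail never ends directly behind
    -- the edge. This rules out `β = π` below.
    have hback : v.y = 0 → v.x < 0 → False := by
      intro h0 hneg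
      have hRpos : 0 < R := by
        rcases hR.eq_or_lt with h | h
        · rw [hvx, ← h] at hneg; simp at hneg
        · exact h
      have hζpi : ζ < Real.pi := by linarith
      have hζ : ζ = 0 := by
        by_contra hne
        have := Real.sin_pos_of_pos_of_lt_pi (lt_of_le_of_ne hζ0 (Ne.symm hne)) hζpi
        have := mul_pos hRpos this
        linarith
      rw [hvx, hζ, Real.cos_zero] at hneg
      linarith
    have hcase : (boost l' v).y = 0 → (boost l' v).x ≤ 0 → False := by
      intro h0 hle
      refine hback h0 ?_
      by_contra! hge
      have h1 := mul_pos (Real.sinh_pos_iff.2 hl') hv.1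
      have h2 := mul_nonneg (Real.cosh_pos l').le hge
      simp only [boost] at hle
      linarith
    have hR'0 : 0 < R' := by
      rcases hR'.eq_or_lt with h | h
      · exfalso
        rw [← h, zero_mul] at ex ey
        exact hcase ey ex.le
      · exact h
    refine ⟨R', β, hR'0, hβ0, ?_, ex, ey⟩
    refine le_pi_of_sin_nonneg ?_ ?_
    · by_contra! hge
      have hβ : β = Real.pi := by linarith
      rw [hβ] at ex ey
      rw [Real.sin_pi, mul_zero] at ey
      rw [Real.cos_pi] at ex
      exact hcase ey (by linarith)
    · rw [hox, hoy, ex, ey] at hX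
      have h1 : 0 ≤ ρ * R' * Real.sin (τ + β) := by
        rw [Real.sin_add]; linarith
      exact nonneg_of_mul_nonneg_right h1 (mul_pos hρ hR'0)
  · rcases hg with rfl | ⟨hζ2, hot⟩
    · exact ⟨le_rfl, fun _ => Or.inl rfl⟩
    · refine dot_boost_le_of_obtuse ho hv hl hll hoy0 hot ?_ ?_ hS
      · rw [hNx]
        exact mul_nonneg hρ'.le (Real.cos_nonneg_of_mem_Icc ⟨by linarith, by linarith⟩)
      · rw [hvx]
        exact mul_nonpos_of_nonneg_of_nonpos hR
          (Real.cos_nonpos_of_pi_div_two_le_of_le hζ2 (by linarith))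

/-- The effect of opening one angle. -/
theorem dot_rot_le_of_le {n w : LVec} {σ a a' R β : ℝ} (hn : HasSlope n σ) (hσ : 0 ≤ σ)
    (hR : 0 < R) (hβ : 0 ≤ β) (hx : w.x = R * Real.cos β) (hy : w.y = R * Real.sin β)
    (ha' : 0 ≤ a') (ha : a' ≤ a) (hpi : σ + a + β ≤ Real.pi) :
    dot n (rot a w) ≤ dot n (rot a' w) ∧ (dot n (rot a w) = dot n (rot a' w) → a = a') := by
  obtain ⟨ρ, hρ, hnx, hny⟩ := hn
  have key : ∀ b, dot n (rot b w) = n.t * w.t + ρ * R * Real.cos (σ + b + β) := by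
    intro b
    simp only [dot, rot, hnx, hny, hx, hy, Real.cos_add, Real.sin_add]; ring
  rw [key, key]
  have hp := mul_pos hρ hR
  constructor
  · have := Real.cos_le_cos_of_nonneg_of_le_pi (by linarith : 0 ≤ σ + a' + β) hpi (by linarith)
    have := mul_le_mul_of_nonneg_left this hp.le
    linarith
  · intro h
    have h1 : ρ * R * Real.cos (σ + a + β) = ρ * R * Real.cos (σ + a' + β) := by linarith
    have h2 := Real.injOn_cos ⟨by linarith, hpi⟩ ⟨by linarith, by linarith⟩
      (mul_left_cancel₀ hp.ne' h1)
    linarith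

/-- Compatibility of the data of two arms with `r` edges: angles open, and edges grow only between
two obtuse turns. -/
structure ArmOpens (r : ℕ) (a l a' l' : ℕ → ℝ) : Prop where
  nonneg : ∀ i < r, 0 ≤ a' i
  le : ∀ i < r, a' i ≤ a i
  lt_pi : ∀ i < r, a i < Real.pi
  pos : ∀ i < r, 0 < l i
  length_le : ∀ i < r, l i ≤ l' i
  grow : ∀ i < r, l i = l' i ∨ ((i = 0 ∨ Real.pi / 2 ≤ a i) ∧ i + 1 < r ∧
    Real.pi / 2 ≤ a' (i + 1))

/-- Half of the arm lemma: opening an arm that descends all the way from its first vertex moves the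
free endpoint forward. -/
theorem dot_endpt_le : ∀ (r : ℕ) (a l a' l' : ℕ → ℝ) (n : LVec) (σ : ℝ), IsUnitCovec n →
    0 ≤ σ → σ ≤ Real.pi → HasSlope n σ → (0 < r → 0 < σ + a 0) → ArmOpens r a l a' l' →
    (0 < r → l 0 = l' 0 ∨ 0 < σ ∧ Real.pi / 2 ≤ a 0 ∨ 0 ≤ n.t ∧ σ = 0) →
    (∀ i < r, (coframe (i + 1) a l n).y ≤ 0) →
    (∃ ζ, 0 ≤ ζ ∧ σ + ζ ≤ Real.pi ∧ (0 < r → a' 0 ≤ ζ) ∧ HasArg (endpt r a' l') ζ) ∧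
      dot n (endpt r a l) ≤ dot n (endpt r a' l') ∧
      (dot n (endpt r a l) = dot n (endpt r a' l') →
        (∀ i < r, a i = a' i) ∧ (∀ i < r, i ≠ 0 → l i = l' i) ∧
        (0 < r → l 0 = l' 0 ∨ (σ = 0 ∧ (rot (-a 0) n).t = 0 ∧ (rot (-a 0) n).x = 0))) := by
  intro r
  induction r with
  | zero =>
    intro a l a' l' n σ _ _ hσpi _ _ _ _ _
    refine ⟨⟨0, le_rfl, by linarith, fun h => absurd h (lt_irrefl _), 0, le_rfl, ?_, ?_⟩, le_rfl,
      fun _ => ⟨?_, ?_, ?_⟩⟩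
    · simp [endpt, origin]
    · simp [endpt, origin]
    all_goals intros; omega
  | succ r ih =>
    intro a l a' l' n σ hn hσ0 hσpi hnσ hpos hA h0 hdown
    have hr : 0 < r + 1 := Nat.succ_pos r
    have hpos := hpos hr
    have h0 := h0 hr
    have ha0 := hA.nonneg 0 hr
    have haa := hA.le 0 hr
    have hapi := hA.lt_pi 0 hr
    have hl := hA.pos 0 hr
    have hll := hA.length_le 0 hr
    set o := rot (-a 0) n with ho
    have hou : IsUnitCovec o := hn.rot _
    have hoτ : HasSlope o (σ + a 0) := hnσ.rot _
    have hoy : o.y ≤ 0 := hdown 0 hr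
    -- The slope is below 2π, and its sine is nonnegative because the first edge descends.
    have hτ : σ + a 0 ≤ Real.pi := by
      obtain ⟨ρ, hρ, hx, hy⟩ := hoτ
      refine le_pi_of_sin_nonneg (by linarith) ?_
      have : 0 ≤ ρ * Real.sin (σ + a 0) := by linarith
      exact nonneg_of_mul_nonneg_right this hρ
    obtain ⟨σ', hσ'0, hσ'pi, hN⟩ := hoτ.boost hou hpos hτ (l 0)
    have hA' : ArmOpens r (fun i => a (i + 1)) (fun i => l (i + 1)) (fun i => a' (i + 1))
        (fun i => l' (i + 1)) :=
      ⟨fun i hi => hA.nonneg _ (by omega), fun i hi => hA.le _ (by omega),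
        fun i hi => hA.lt_pi _ (by omega), fun i hi => hA.pos _ (by omega),
        fun i hi => hA.length_le _ (by omega), fun i hi => by
          rcases hA.grow (i + 1) (by omega) with h | ⟨h1, h2, h3⟩
          · exact Or.inl h
          · exact Or.inr ⟨Or.inr (h1.resolve_left (by omega)), by omega, h3⟩⟩
    -- Data are exchanged from the far end inwards: the tail, then the length of the first edge,
    -- then the first turn. Each exchange leaves the free end below the current vertex, as the next
    -- one requires.
    obtain ⟨⟨ζ, hζ0, hζpi, hζa, hζ⟩, hle, heq⟩ := ih (fun i => a (i + 1)) (fun i => l (i + 1))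
      (fun i => a' (i + 1)) (fun i => l' (i + 1)) (boost (l 0) o) σ' (hou.boost _) hσ'0.le hσ'pi hN
      (fun h => by
        have h1 := hA.nonneg 1 (by omega)
        have h2 := hA.le 1 (by omega)
        simp only [zero_add]
        linarith) hA'
      (fun h => by
        rcases hA.grow 1 (by omega) with h | ⟨h1, h2, h3⟩
        · exact Or.inl h
        · exact Or.inr (Or.inl ⟨hσ'0, h1.resolve_left one_ne_zero⟩))
      (fun i hi => hdown (i + 1) (by omega))
    set v' := endpt r (fun i => a' (i + 1)) (fun i => l' (i + 1)) with hv'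
    set v := endpt r (fun i => a (i + 1)) (fun i => l (i + 1)) with hv
    -- For a growing edge, `ζ` is at least the next turn, so the tail points backward. The remaining
    -- condition on `o` holds because the slope is at least π/2, or, if `σ = 0`, because `n.t ≥ 0`
    -- and rotation preserves the time coordinate.
    have hg : l 0 = l' 0 ∨ (Real.pi / 2 ≤ ζ ∧ (0 ≤ o.t ∨ o.x ≤ 0)) := by
      rcases hA.grow 0 hr with h | ⟨h1, h2, h3⟩
      · exact Or.inl h
      rcases h0 with h | h | h
      · exact Or.inl h
      · refine Or.inr ⟨h3.trans (hζa (by omega)), Or.inr ?_⟩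
        obtain ⟨ρ, hρ, hx, hy⟩ := hoτ
        rw [hx]
        exact mul_nonpos_of_nonneg_of_nonpos hρ.le
          (Real.cos_nonpos_of_pi_div_two_le_of_le (by linarith) (by linarith))
      · exact Or.inr ⟨h3.trans (hζa (by omega)), Or.inl h.1⟩
    obtain ⟨⟨R, β, hR, hβ0, hβpi, ex, ey⟩, hle2, heq2⟩ := exists_hasArg_boost hou hpos hτ hoτ hσ'0 hN
      (onSheet_endpt _ _ _) hζ hζ0 hζpi hl hll hg
    obtain ⟨hle3, heq3⟩ := dot_rot_le_of_le hnσ hσ0 hR hβ0 ex ey ha0 haa hβpi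
    have e1 : dot n (endpt (r + 1) a l) = dot (boost (l 0) o) v := by
      rw [endpt, ← dot_rot_neg, dot_boost]
    have e2 : dot n (endpt (r + 1) a' l') = dot n (rot (a' 0) (boost (l' 0) v')) := rfl
    have e3 : dot (boost (l 0) o) v' = dot o (boost (l 0) v') := dot_boost _ _ _
    have e4 : dot o (boost (l' 0) v') = dot n (rot (a 0) (boost (l' 0) v')) := dot_rot_neg _ _ _
    refine ⟨⟨a' 0 + β, by linarith, by linarith, fun _ => by linarith, ?_⟩, by linarith, ?_⟩
    · exact HasArg.rot ⟨R, hR.le, ex, ey⟩ _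
    · intro h
      obtain ⟨q1, q2, q3⟩ := heq (by linarith)
      have q4 := heq2 (by linarith)
      have q5 := heq3 (by linarith)
      refine ⟨?_, ?_, fun _ => ?_⟩
      · rintro (_ | i) hi
        · exact q5
        · exact q1 i (by omega)
      · rintro (_ | _ | i) hi hne
        · exact absurd rfl hne
        · exact (q3 (by omega)).resolve_right fun h => hσ'0.ne' h.1
        · exact q2 (i + 1) (by omega) (by omega)
      · rcases q4 with h | ⟨h1, h2⟩
        · exact Or.inl h
        rcases hσ0.eq_or_lt with h3 | h3
        · exact Or.inr ⟨h3.symm, h1, h2⟩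
        rcases h0 with h | h | h
        · exact Or.inl h
        -- Here `σ > 0` makes the slope exceed π/2, so `o.x < 0` and the edge cannot lie on the
        -- geodesic.
        · exfalso
          obtain ⟨ρ, hρ, hx, hy⟩ := hoτ
          have : Real.cos (σ + a 0) < 0 :=
            Real.cos_neg_of_pi_div_two_lt_of_lt (by linarith) (by linarith)
          have := mul_neg_of_pos_of_neg hρ this
          linarith
        · exact absurd h.2 h3.ne'

/-! ### Broken geodesics and their endpoints -/

/-- A broken geodesic with `r` edges of lengths `l i` from `v i` to `v (i + 1)`, which turns left by
the angle `a i` at the vertex `v i`. -/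
structure IsChain (r : ℕ) (v : ℕ → LVec) (l a : ℕ → ℝ) : Prop where
  sheet : ∀ i ≤ r, OnSheet (v i)
  pos : ∀ i < r, 0 < l i
  edge : ∀ i < r, bil (v i) (v (i + 1)) = Real.cosh (l i)
  turn : ∀ i, i + 1 < r → Turn (v i) (v (i + 1)) (v (i + 2)) (l i) (l (i + 1)) (a (i + 1))

namespace IsChain

variable {r : ℕ} {v : ℕ → LVec} {l a : ℕ → ℝ}

theorem tail (h : IsChain (r + 1) v l a) :
    IsChain r (fun i => v (i + 1)) (fun i => l (i + 1)) (fun i => a (i + 1)) :=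
  ⟨fun i hi => h.sheet _ (by omega), fun i hi => h.pos _ (by omega),
    fun i hi => h.edge _ (by omega), fun i hi => h.turn _ (by omega)⟩

theorem take {m : ℕ} (h : IsChain r v l a) (hm : m ≤ r) : IsChain m v l a :=
  ⟨fun i hi => h.sheet _ (by omega), fun i hi => h.pos _ (by omega),
    fun i hi => h.edge _ (by omega), fun i hi => h.turn _ (by omega)⟩

theorem drop {q m : ℕ} (h : IsChain (q + m) v l a) :
    IsChain m (fun i => v (q + i)) (fun i => l (q + i)) (fun i => a (q + i)) :=
  ⟨fun i hi => h.sheet _ (by omega), fun i hi => h.pos _ (by omega),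
    fun i hi => h.edge _ (by omega), fun i hi => h.turn (q + i) (by omega)⟩

/-- A chain does not turn at its starting vertex; the value at index 0 is free to record the
direction of the first edge. -/
theorem congr_angle {b : ℕ → ℝ} (h : IsChain r v l a) (hb : ∀ i, b (i + 1) = a (i + 1)) :
    IsChain r v l b :=
  ⟨h.sheet, h.pos, h.edge, fun i hi => by rw [hb]; exact h.turn i hi⟩

theorem map (h : IsChain r v l a) (f : LVec → LVec) (hf : ∀ i ≤ r, OnSheet (f (v i)))
    (hb : ∀ u w, bil (f u) (f w) = bil u w) (hd : ∀ u w x, det (f u) (f w) (f x) = det u w x) :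
    IsChain r (fun i => f (v i)) l a :=
  ⟨hf, h.pos, fun i hi => by rw [hb]; exact h.edge i hi,
    fun i hi => by
      obtain ⟨h1, h2⟩ := h.turn i hi
      exact ⟨by rw [hb, h1], by rw [hd, h2]⟩⟩

/-- Reversal turns left turns into right turns and the reflection undoes this, so the two arms at a
vertex fall under the same lemma. -/
theorem reverse (h : IsChain r v l a) :
    IsChain r (fun i => mirror (v (r - i))) (fun i => l (r - 1 - i)) (fun i => a (r - i)) := by
  refine ⟨fun i hi => (h.sheet _ (by omega)).mirror, fun i hi => h.pos _ (by omega),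
    fun i hi => ?_, fun i hi => ?_⟩
  · have := h.edge (r - 1 - i) (by omega)
    rw [bil_mirror, bil_comm, ← this, show r - i = r - 1 - i + 1 by omega,
      show r - (i + 1) = r - 1 - i by omega]
  · obtain ⟨h1, h2⟩ := h.turn (r - (i + 2)) (by omega)
    rw [show r - (i + 2) + 1 = r - (i + 1) by omega, show r - (i + 2) + 2 = r - i by omega] at h1 h2
    have e1 : r - 1 - (i + 1) = r - (i + 2) := by omega
    have e2 : r - 1 - i = r - (i + 1) := by omega
    refine ⟨?_, ?_⟩
    · rw [e1, e2, bil_mirror, bil_comm]; linarith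
    · rw [e1, e2, det_mirror, det_swap, det_rotate, det_rotate, neg_neg]; linarith

theorem coord_eq (h : IsChain (r + 1) v l a) :
    coord (v 0) (v 1) (l 0) (v (r + 1))
      = boost (l 0) (endpt r (fun i => a (i + 1)) (fun i => l (i + 1))) := by
  induction r generalizing v l a with
  | zero =>
    have hs := (Real.sinh_pos_iff.2 (h.pos 0 (by omega))).ne'
    have h1 := (h.sheet 1 (by omega)).2
    have h2 := h.edge 0 (by omega)
    rw [zero_add] at h2
    simp only [coord, boost, endpt, origin, zero_add, h1, h2]
    ext
    · simp
    · simp only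
      field_simp
      linear_combination Real.cosh_sq (l 0)
    · have : det (v 0) (v 1) (v 1) = 0 := by simp only [det]; ring
      simp [this]
  | succ r ih =>
    have h1 := coord_eq_boost_rot (h.sheet 1 (by omega)) (h.sheet 2 (by omega))
      (h.pos 0 (by omega)) (h.pos 1 (by omega)) (h.edge 0 (by omega)) (h.edge 1 (by omega))
      (h.turn 0 (by omega)) (v (r + 1 + 1))
    rw [h1]
    exact congrArg (fun w => boost (l 0) (rot (a 1) w)) (ih h.tail)

theorem rot_coord_eq (h : IsChain (r + 1) v l a) :
    rot (a 0) (coord (v 0) (v 1) (l 0) (v (r + 1))) = endpt (r + 1) a l := by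
  rw [h.coord_eq]; rfl

end IsChain

theorem endpt_congr {r : ℕ} {a l a' l' : ℕ → ℝ} (ha : ∀ i < r, a i = a' i)
    (hl : ∀ i < r, l i = l' i) : endpt r a l = endpt r a' l' := by
  induction r generalizing a l a' l' with
  | zero => rfl
  | succ r ih =>
    rw [endpt, endpt, ha 0 (by omega), hl 0 (by omega),
      ih (fun i hi => ha (i + 1) (by omega)) (fun i hi => hl (i + 1) (by omega))]

/-- The span of a broken geodesic is determined by its edge lengths and angles. -/
theorem IsChain.bil_eq_bil {r : ℕ} {v v' : ℕ → LVec} {l l' a a' : ℕ → ℝ}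
    (h : IsChain (r + 1) v l a) (h' : IsChain (r + 1) v' l' a') (hl : ∀ i < r + 1, l i = l' i)
    (ha : ∀ i < r, a (i + 1) = a' (i + 1)) :
    bil (v 0) (v (r + 1)) = bil (v' 0) (v' (r + 1)) := by
  have h1 := congrArg LVec.t h.coord_eq
  have h2 := congrArg LVec.t h'.coord_eq
  have h3 : endpt r (fun i => a (i + 1)) (fun i => l (i + 1))
      = endpt r (fun i => a' (i + 1)) (fun i => l' (i + 1)) :=
    endpt_congr ha (fun i hi => hl (i + 1) (by omega))
  rw [h3, hl 0 (by omega), ← h2] at h1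
  exact h1

/-- The covector that corresponds to a vector under the Lorentz form, up to sign. -/
def flip (v : LVec) : LVec := ⟨-v.t, v.x, v.y⟩

theorem boost_flip_boost (l : ℝ) (v : LVec) : boost l (flip (boost l v)) = flip v := by
  have h := Real.cosh_sq_sub_sinh_sq l
  ext <;> simp only [boost, flip]
  · linear_combination (-v.t) * h
  · linear_combination v.x * h

theorem rot_neg_flip_rot (a : ℝ) (v : LVec) : rot (-a) (flip (rot a v)) = flip v := by
  have h := Real.sin_sq_add_cos_sq a
  ext <;> simp only [rot, flip, Real.cos_neg, Real.sin_neg]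
  · linear_combination v.x * h
  · linear_combination v.y * h

/-- The functional is minus the Lorentz product with `w`. In the frame of an edge its second
coordinate is that of `w`, which a boost along the edge preserves; its sign tells on which side of
the edge `w` lies. -/
theorem IsChain.coframe_y {r : ℕ} {v : ℕ → LVec} {l a : ℕ → ℝ} {n w : LVec}
    (h : IsChain r v l a) (h0 : rot (-a 0) n = flip (coord (v 0) (v 1) (l 0) w)) (i : ℕ)
    (hi : i < r) : (coframe (i + 1) a l n).y = det (v i) (v (i + 1)) w / Real.sinh (l i) := by
  induction i generalizing r v l a n with
  | zero =>
    rw [coframe, coframe, h0]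
    rfl
  | succ i ih =>
    obtain ⟨r, rfl⟩ : ∃ k, r = k + 1 := ⟨r - 1, by omega⟩
    rw [coframe]
    refine ih h.tail ?_ (by omega)
    have h1 := coord_eq_boost_rot (h.sheet 1 (by omega)) (h.sheet 2 (by omega))
      (h.pos 0 (by omega)) (h.pos 1 (by omega)) (h.edge 0 (by omega)) (h.edge 1 (by omega))
      (h.turn 0 (by omega)) w
    rw [h0, h1, boost_flip_boost, rot_neg_flip_rot]

/-- Looking back from `q` to `p` reverses both axes. Reflecting the whole picture restores the
second axis, and the outer `mirror` restores the first. -/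
theorem coord_eq_boost_mirror {p q : LVec} {l : ℝ} (hl : 0 < l) (w : LVec) :
    coord p q l w = boost l (mirror (coord (mirror q) (mirror p) l (mirror w))) := by
  have hs := (Real.sinh_pos_iff.2 hl).ne'
  have hc := Real.cosh_sq l
  have e : det (mirror q) (mirror p) (mirror w) = det p q w := by
    rw [det_mirror, det_swap q p w, neg_neg]
  simp only [coord, bil_mirror, e]
  ext
  · simp only [boost, mirror]
    field_simp
    ring
  · simp only [boost, mirror]
    field_simp
    linear_combination (bil q w) * hc
  · rfl

/-- The law of cosines for the two arms that meet at `q`, in terms of their coordinates relative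
to a line that splits the turning angle. -/
theorem bil_eq_of_turn {p q r : LVec} {l l' a s s' : ℝ} (hp : OnSheet p) (hq : OnSheet q)
    (hr : OnSheet r) (hl : 0 < l) (hl' : 0 < l') (h : bil p q = Real.cosh l)
    (h' : bil q r = Real.cosh l') (ht : Turn p q r l l' a) (hs : s + s' = a) (u w : LVec) :
    bil u w
      = (rot s (coord (mirror q) (mirror p) l (mirror u))).t * (rot s' (coord q r l' w)).t
        + (rot s (coord (mirror q) (mirror p) l (mirror u))).x * (rot s' (coord q r l' w)).x
        - (rot s (coord (mirror q) (mirror p) l (mirror u))).y * (rot s' (coord q r l' w)).y := by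
  rw [← bil_coord hp hq hl h u w, coord_eq_boost_mirror hl u,
    coord_eq_boost_rot hq hr hl hl' h h' ht w, bil_boost, ← hs]
  generalize coord (mirror q) (mirror p) l (mirror u) = A
  generalize coord q r l' w = B
  simp only [bil, mirror, rot, Real.cos_add, Real.sin_add]
  ring

/-- Turning angles of the arm that starts at vertex `q`, the first one being `s`. -/
def armAngles (s : ℝ) (b : ℕ → ℝ) (i : ℕ) : ℝ := if i = 0 then s else b i

/-- The left arm is reversed and reflected, hence the sign of `A.x * B.x`: the right side is the
Lorentz product of `mirror A` and `B`. -/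
theorem IsChain.bil_eq_of_split {q m : ℕ} {v : ℕ → LVec} {l a : ℕ → ℝ} {s s' : ℝ}
    (h : IsChain (q + 1 + (m + 1)) v l a) (hs : s + s' = a (q + 1)) :
    ∃ A B : LVec, A = endpt (q + 1) (armAngles s fun i => a (q + 1 - i)) (fun i => l (q - i)) ∧
      B = endpt (m + 1) (armAngles s' fun i => a (q + 1 + i)) (fun i => l (q + 1 + i)) ∧
      bil (v 0) (v (q + 1 + (m + 1))) = A.t * B.t + A.x * B.x - A.y * B.y := by
  refine ⟨_, _, rfl, rfl, ?_⟩
  have h1 := (((h.take (m := q + 1) (by omega)).reverse).congr_angle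
    (b := armAngles s fun i => a (q + 1 - i)) (fun i => rfl)).rot_coord_eq
  have h2 := (h.drop.congr_angle
    (b := armAngles s' fun i => a (q + 1 + i)) (fun i => rfl)).rot_coord_eq
  simp only [add_tsub_cancel_right, tsub_zero, tsub_self] at h1
  rw [← h1, ← h2]
  exact bil_eq_of_turn (h.sheet q (by omega)) (h.sheet (q + 1) (by omega))
    (h.sheet (q + 2) (by omega)) (h.pos q (by omega)) (h.pos (q + 1) (by omega))
    (h.edge q (by omega)) (h.edge (q + 1) (by omega)) (h.turn q (by omega)) hs _ _

theorem rot_coord_origin {p : LVec} {l s : ℝ} (hl : 0 < l)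
    (hp : p = ⟨Real.cosh l, Real.sinh l * Real.cos s, Real.sinh l * Real.sin s⟩) (w : LVec) :
    rot s (coord origin p l w) = w := by
  have hs := (Real.sinh_pos_iff.2 hl).ne'
  have h := Real.sin_sq_add_cos_sq s
  have e1 : (Real.cosh l * bil origin w - bil p w) / Real.sinh l
      = Real.cos s * w.x + Real.sin s * w.y := by
    rw [hp]; simp only [bil, origin]
    field_simp
    ring
  have e2 : det origin p w / Real.sinh l = Real.cos s * w.y - Real.sin s * w.x := by
    rw [hp]; simp only [det, origin]
    field_simp
    ring
  have e3 : bil origin w = w.t := by simp [bil, origin]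
  rw [coord, e1, e2, e3]
  ext <;> simp only [rot]
  · linear_combination w.x * h
  · linear_combination w.y * h

theorem OnSheet.eq_of_proportional {u v : LVec} (hu : OnSheet u) (hv : OnSheet v)
    (hx : u.x * v.t = u.t * v.x) (hy : u.y * v.t = u.t * v.y) : u = v := by
  have h1 := hu.sq
  have h2 := hv.sq
  have h3 : u.t ^ 2 * v.t ^ 2 = v.t ^ 2 + (u.x * v.t) ^ 2 + (u.y * v.t) ^ 2 := by
    rw [h1]; ring
  rw [hx, hy] at h3
  have h4 : u.t ^ 2 = v.t ^ 2 := by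
    have : u.t ^ 2 * v.t ^ 2 = u.t ^ 2 * (1 + v.x ^ 2 + v.y ^ 2) := by rw [h2]
    linarith
  have ht : u.t = v.t := (pow_left_inj₀ hu.1.le hv.1.le two_ne_zero).1 h4
  rw [ht, mul_comm] at hx hy
  exact LVec.ext ht (mul_left_cancel₀ hv.1.ne' hx) (mul_left_cancel₀ hv.1.ne' hy)

/-! ### Convex chains seen from their highest vertex -/

/-- In a convex chain with highest vertex at the base point and endpoint `c` on the base line, which
passes through `z`, every edge `a b` descends. -/
theorem descends_of_convex {a b c z : LVec} {s k : ℝ} (hs : 0 < s) (hk : 0 < k)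
    (hz : ∀ w, det z w c = s * (k * w.t - w.y)) (ha : OnSheet a) (hc : OnSheet c) (hac : a ≠ c)
    (hao : a ≠ origin) (h1 : 0 ≤ det origin a b) (h2 : 0 ≤ det a b c) (h3 : 0 ≤ det origin a c)
    (h4 : 0 ≤ det z a b) (h5 : 0 ≤ det z a c) (h6 : det z a c ≤ s * k) :
    0 ≤ a.t * b.y - a.y * b.t := by
  have hcy : c.y = k * c.t := by
    have e : det z c c = 0 := by simp only [det]; ring
    rw [hz] at e
    have := (mul_eq_zero.1 e).resolve_left hs.ne'
    linarith
  have hat : 1 < a.t := by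
    refine lt_of_le_of_ne ha.one_le fun h => hao ?_
    refine ha.eq_of_bil_eq_one onSheet_origin ?_
    simp [bil, origin, ← h]
  rw [hz] at h5 h6
  have h5' : 0 ≤ k * a.t - a.y := nonneg_of_mul_nonneg_right h5 hs
  have h6' : k * a.t - a.y ≤ k := le_of_mul_le_mul_left h6 hs
  have hay : 0 < a.y := by
    have := mul_pos hk (sub_pos.2 hat)
    linarith
  have hH : a.t * c.y - a.y * c.t = c.t * (k * a.t - a.y) := by rw [hcy]; ring
  have hH0 : 0 ≤ a.t * c.y - a.y * c.t := by rw [hH]; exact mul_nonneg hc.1.le h5'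
  -- Linear relations among four vectors of a three-dimensional space. The first settles the sign
  -- unless `origin`, `a`, `c` are collinear; the second, with `z` in place of `origin`, covers that
  -- case.
  have id1 : a.y * det a b c + (a.t * c.y - a.y * c.t) * det origin a b
      = (a.t * b.y - a.y * b.t) * det origin a c := by
    simp only [det, origin]; ring
  have id2 : (z.t * a.y - z.y * a.t) * det a b c + (a.t * c.y - a.y * c.t) * det z a b
      = (a.t * b.y - a.y * b.t) * det z a c := by
    simp only [det]; ring
  have p1 := mul_nonneg hay.le h2
  have p2 := mul_nonneg hH0 h1
  rcases h3.eq_or_lt with h0 | hpos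
  · rw [← h0, mul_zero] at id1
    have e1 : det a b c = 0 := by
      have : a.y * det a b c = 0 := by linarith
      exact (mul_eq_zero.1 this).resolve_left hay.ne'
    rw [e1, mul_zero, zero_add, hz] at id2
    have hpos : 0 < k * a.t - a.y := by
      refine lt_of_le_of_ne h5' fun h => hac ?_
      have hay : a.y = k * a.t := by linarith
      refine ha.eq_of_proportional hc ?_ (by rw [hay, hcy]; ring)
      have e2 : det origin a c = k * (a.x * c.t - a.t * c.x) := by
        simp only [det, origin, hay, hcy]; ring
      rw [← h0] at e2
      have := (mul_eq_zero.1 e2.symm).resolve_left hk.ne'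
      linarith
    have p3 := mul_nonneg hH0 h4
    rw [id2] at p3
    exact nonneg_of_mul_nonneg_left p3 (mul_pos hs hpos)
  · rw [← not_lt]
    intro hneg
    have := mul_neg_of_neg_of_pos hneg hpos
    linarith

/-- Opening one of the two arms that meet at the highest vertex of a convex chain. -/
theorem arm_opens_le {r : ℕ} {v : ℕ → LVec} {l a l' a' : ℕ → ℝ} {z : LVec} {s k : ℝ}
    (hv : IsChain (r + 1) v l a) (hv0 : v 0 = origin)
    (hv1 : v 1 = ⟨Real.cosh (l 0), Real.sinh (l 0) * Real.cos (a 0),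
      Real.sinh (l 0) * Real.sin (a 0)⟩)
    (ha0 : 0 < a 0) (hA : ArmOpens (r + 1) a l a' l') (hs : 0 < s) (hk : 0 < k)
    (hz : ∀ w, det z w (v (r + 1)) = s * (k * w.t - w.y))
    (hlow : ∀ i ≤ r + 1, 0 ≤ det z (v i) (v (r + 1)))
    (hhigh : ∀ i ≤ r + 1, det z (v i) (v (r + 1)) ≤ s * k)
    (hd : ∀ i j m, i < j → j < m → m ≤ r + 1 → 0 ≤ det (v i) (v j) (v m))
    (hdz : ∀ i j, i < j → j ≤ r + 1 → 0 ≤ det z (v i) (v j))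
    (hne : ∀ i j, i < j → j ≤ r + 1 → v i ≠ v j) :
    v (r + 1) = endpt (r + 1) a l ∧ (v (r + 1)).x ≤ (endpt (r + 1) a' l').x ∧
      ((v (r + 1)).x = (endpt (r + 1) a' l').x → (∀ i < r + 1, a i = a' i ∧ l i = l' i) ∨
        (l 0 ≠ l' 0 ∧ k * (endpt (r + 1) a' l').t < (endpt (r + 1) a' l').y)) := by
  have hl0 := hv.pos 0 (by omega)
  have hsh := (Real.sinh_pos_iff.2 hl0)
  have hend : v (r + 1) = endpt (r + 1) a l := by
    rw [← hv.rot_coord_eq, hv0, rot_coord_origin hl0 hv1]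
  have hdot : ∀ w, dot ⟨0, 1, 0⟩ w = w.x := fun w => by simp [dot]
  -- The first coordinate, as a functional, is minus the Lorentz product with ⟨0, 1, 0⟩, so
  -- `coframe_y` applies to this vector.
  have hbase : rot (-a 0) ⟨0, 1, 0⟩ = flip (coord (v 0) (v 1) (l 0) ⟨0, 1, 0⟩) := by
    rw [hv0, hv1]
    ext
    · simp [rot, flip, coord, bil, origin]
    · simp only [rot, flip, coord, bil, origin, Real.cos_neg, Real.sin_neg]
      field_simp
      ring
    · simp only [rot, flip, coord, det, origin, Real.cos_neg, Real.sin_neg]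
      field_simp
      ring
  have hdown : ∀ i < r + 1, (coframe (i + 1) a l ⟨0, 1, 0⟩).y ≤ 0 := by
    intro i hi
    rw [hv.coframe_y hbase i hi]
    refine div_nonpos_of_nonpos_of_nonneg ?_ (Real.sinh_nonneg_iff.2 (hv.pos i hi).le)
    have e : det (v i) (v (i + 1)) ⟨0, 1, 0⟩
        = -((v i).t * (v (i + 1)).y - (v i).y * (v (i + 1)).t) := by simp only [det]; ring
    rw [e, neg_nonpos]
    rcases Nat.eq_zero_or_pos i with rfl | hipos
    · have h1 := hhigh 1 (by omega)
      have h2 := (hv.sheet 1 (by omega)).one_le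
      rw [hz] at h1
      have h3 := le_of_mul_le_mul_left h1 hs
      have h4 := mul_nonneg hk.le (sub_nonneg.2 h2)
      simp only [hv0, zero_add, origin]
      linarith
    · have hdet : 0 ≤ det (v i) (v (i + 1)) (v (r + 1)) := by
        rcases (show i + 1 ≤ r + 1 by omega).eq_or_lt with h | h
        · rw [h]
          have : det (v i) (v (r + 1)) (v (r + 1)) = 0 := by simp only [det]; ring
          exact this.ge
        · exact hd _ _ _ (by omega) h le_rfl
      refine descends_of_convex hs hk hz (hv.sheet i (by omega)) (hv.sheet (r + 1) le_rfl)
        (hne _ _ (by omega) le_rfl) (hv0 ▸ (hne 0 i hipos (by omega)).symm) ?_ hdet ?_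
        (hdz _ _ (by omega) (by omega)) (hlow i (by omega)) (hhigh i (by omega))
      · rw [← hv0]; exact hd _ _ _ hipos (by omega) (by omega)
      · rw [← hv0]; exact hd _ _ _ hipos (by omega) (by omega)
  obtain ⟨-, hle, heq⟩ := dot_endpt_le (r + 1) a l a' l' ⟨0, 1, 0⟩ 0 (by simp [IsUnitCovec]) le_rfl
    Real.pi_pos.le ⟨1, one_pos, by simp, by simp⟩ (fun _ => by simpa using ha0) hA
    (fun _ => Or.inr (Or.inr ⟨le_rfl, rfl⟩)) hdown
  rw [hdot, hdot, ← hend] at hle heq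
  refine ⟨hend, hle, fun h => ?_⟩
  obtain ⟨q1, q2, q3⟩ := heq h
  by_cases hl : l 0 = l' 0
  · left
    intro i hi
    refine ⟨q1 i hi, ?_⟩
    rcases Nat.eq_zero_or_pos i with rfl | hipos
    · exact hl
    · exact q2 i hi hipos.ne'
  -- The exceptional case: the first edge lies on the second axis. With all other data unchanged,
  -- lengthening it keeps `x` and strictly increases `y / t`, which was `k`.
  · right
    refine ⟨hl, ?_⟩
    obtain ⟨-, -, hcos⟩ := (q3 (by omega)).resolve_left hl
    have hcos : Real.cos (a 0) = 0 := by simpa [rot] using hcos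
    have hsin : Real.sin (a 0) = 1 := by
      have h1 := Real.sin_sq_add_cos_sq (a 0)
      have h2 := Real.sin_pos_of_pos_of_lt_pi ha0 (hA.lt_pi 0 (by omega))
      rw [hcos] at h1
      nlinarith
    have hw : endpt r (fun i => a' (i + 1)) (fun i => l' (i + 1))
        = endpt r (fun i => a (i + 1)) (fun i => l (i + 1)) :=
      endpt_congr (fun i hi => (q1 (i + 1) (by omega)).symm)
        (fun i hi => (q2 (i + 1) (by omega) (by omega)).symm)
    have hy : (v (r + 1)).y = k * (v (r + 1)).t := by
      have e : det z (v (r + 1)) (v (r + 1)) = 0 := by simp only [det]; ring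
      rw [hz] at e
      have := (mul_eq_zero.1 e).resolve_left hs.ne'
      linarith
    have hpos := (hv.sheet (r + 1) le_rfl).1
    have hsq := (onSheet_endpt r (fun i => a (i + 1)) (fun i => l (i + 1))).sq
    rw [hend] at hy hpos
    rw [endpt] at hy hpos ⊢
    rw [hw, ← q1 0 (by omega)]
    generalize endpt r (fun i => a (i + 1)) (fun i => l (i + 1)) = w at *
    simp only [rot, boost, hcos, hsin] at hy hpos ⊢
    have hδ : 0 < Real.sinh (l' 0 - l 0) := by
      rw [Real.sinh_pos_iff, sub_pos]
      exact lt_of_le_of_ne (hA.length_le 0 (by omega)) hl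
    have hww : 0 < w.t ^ 2 - w.x ^ 2 := by nlinarith [sq_nonneg w.y]
    have key := mul_pos hδ hww
    rw [Real.sinh_sub] at key
    refine lt_of_mul_lt_mul_right ?_ hpos.le
    have e := congrArg (fun u => u * (Real.cosh (l' 0) * w.t + Real.sinh (l' 0) * w.x)) hy
    linarith

/-! ### Reassembling the two arms -/

/-- Two points on a common geodesic perpendicular to the second axis. -/
theorem bil_of_level {A B : LVec} {k x y : ℝ} (hA : OnSheet A) (hB : OnSheet B)
    (hAk : A.y = k * A.t) (hBk : B.y = k * B.t) (hx : Real.sinh x = A.x) (hy : Real.sinh y = B.x)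
    (hpos : 0 < A.x * B.t + A.t * B.x) :
    A.t * B.t + A.x * B.x - A.y * B.y = Real.cosh (x + y) ∧ 0 < x + y := by
  have cx := Real.cosh_sq x
  have cy := Real.cosh_sq y
  have px := Real.cosh_pos x
  have py := Real.cosh_pos y
  have eA : A.t ^ 2 * (1 - k ^ 2) = Real.cosh x ^ 2 := by
    have := hA.sq
    rw [← hx, hAk] at this; linarith
  have eB : B.t ^ 2 * (1 - k ^ 2) = Real.cosh y ^ 2 := by
    have := hB.sq
    rw [← hy, hBk] at this; linarith
  have hk : 0 < 1 - k ^ 2 := by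
    refine pos_of_mul_pos_right (a := A.t ^ 2) ?_ (sq_nonneg _)
    rw [eA]; positivity
  have e1 : A.t * B.t - A.y * B.y = Real.cosh x * Real.cosh y := by
    have h1 : (A.t * B.t * (1 - k ^ 2)) ^ 2 = (Real.cosh x * Real.cosh y) ^ 2 := by
      rw [mul_pow (Real.cosh x), ← eA, ← eB]; ring
    have h2 := (pow_left_inj₀ (mul_pos (mul_pos hA.1 hB.1) hk).le (mul_pos px py).le
      two_ne_zero).1 h1
    rw [← h2, hAk, hBk]; ring
  have e2 : A.t * Real.cosh y = B.t * Real.cosh x := by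
    have h1 : (A.t * Real.cosh y) ^ 2 = (B.t * Real.cosh x) ^ 2 := by
      rw [mul_pow, mul_pow, ← eA, ← eB]; ring
    exact (pow_left_inj₀ (mul_pos hA.1 py).le (mul_pos hB.1 px).le two_ne_zero).1 h1
  constructor
  · rw [Real.cosh_add, hx, hy, ← e1]; ring
  · rw [← Real.sinh_pos_iff, Real.sinh_add]
    refine pos_of_mul_pos_right (a := A.t) ?_ hA.1.le
    have e3 : A.t * (Real.sinh x * Real.cosh y + Real.cosh x * Real.sinh y)
        = (A.x * B.t + A.t * B.x) * Real.cosh x := by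
      rw [← hx, ← hy]; linear_combination Real.sinh x * e2
    rw [e3]
    exact mul_pos hpos px

theorem OnSheet.abs_y_lt {v : LVec} (h : OnSheet v) : |v.y| < v.t :=
  abs_lt_of_sq_lt_sq (by nlinarith [h.sq, sq_nonneg v.x]) h.1.le

/-- The distance of two points is at least the distance of their signed projections. -/
theorem cosh_add_le_bil {A B : LVec} {x y : ℝ} (hA : OnSheet A) (hB : OnSheet B)
    (hx : Real.sinh x = A.x) (hy : Real.sinh y = B.x) :
    Real.cosh (x + y) ≤ A.t * B.t + A.x * B.x - A.y * B.y ∧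
      (Real.cosh (x + y) = A.t * B.t + A.x * B.x - A.y * B.y → A.t * B.y = A.y * B.t) := by
  have hKpos : 0 < A.t * B.t - A.y * B.y := by
    have h1 : |A.y * B.y| < A.t * B.t := by
      rw [abs_mul]; exact mul_lt_mul'' hA.abs_y_lt hB.abs_y_lt (abs_nonneg _) (abs_nonneg _)
    linarith [(abs_lt.1 h1).2]
  have hK : (A.t * B.t - A.y * B.y) ^ 2
      = (Real.cosh x * Real.cosh y) ^ 2 + (A.t * B.y - A.y * B.t) ^ 2 := by
    have h1 : Real.cosh x ^ 2 = A.t ^ 2 - A.y ^ 2 := by rw [Real.cosh_sq, hx, hA.sq]; ring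
    have h2 : Real.cosh y ^ 2 = B.t ^ 2 - B.y ^ 2 := by rw [Real.cosh_sq, hy, hB.sq]; ring
    rw [mul_pow, h1, h2]; ring
  have e : Real.cosh x * Real.cosh y ≤ A.t * B.t - A.y * B.y := by
    refine (abs_le_of_sq_le_sq' ?_ hKpos.le).2
    rw [hK]; exact le_add_of_nonneg_right (sq_nonneg _)
  have hc : Real.cosh (x + y) = Real.cosh x * Real.cosh y + A.x * B.x := by
    rw [Real.cosh_add, hx, hy]
  rw [hc]
  refine ⟨by linarith only [e], fun h => ?_⟩
  have h3 : A.t * B.t - A.y * B.y = Real.cosh x * Real.cosh y := by linarith only [h]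
  rw [h3] at hK
  have h4 : (A.t * B.y - A.y * B.t) ^ 2 = 0 := by linarith only [hK]
  exact sub_eq_zero.1 (pow_eq_zero_iff two_ne_zero |>.1 h4)

/-- Before opening, the free ends lie on a common perpendicular to the second axis, so their
distance is exactly the sum of their signed distances from it. This sum is positive and does not
decrease, and after opening it is only a lower bound for the distance. -/
theorem bil_arms_le {A B A' B' : LVec} {k : ℝ} (hA : OnSheet A) (hB : OnSheet B) (hA' : OnSheet A')
    (hB' : OnSheet B') (hAk : A.y = k * A.t) (hBk : B.y = k * B.t)
    (hpos : 0 < A.x * B.t + A.t * B.x) (hAA : A.x ≤ A'.x) (hBB : B.x ≤ B'.x) :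
    A.t * B.t + A.x * B.x - A.y * B.y ≤ A'.t * B'.t + A'.x * B'.x - A'.y * B'.y ∧
      (A.t * B.t + A.x * B.x - A.y * B.y = A'.t * B'.t + A'.x * B'.x - A'.y * B'.y →
        A.x = A'.x ∧ B.x = B'.x ∧ A'.t * B'.y = A'.y * B'.t) := by
  obtain ⟨x, hx⟩ := Real.sinh_surjective A.x
  obtain ⟨y, hy⟩ := Real.sinh_surjective B.x
  obtain ⟨x', hx'⟩ := Real.sinh_surjective A'.x
  obtain ⟨y', hy'⟩ := Real.sinh_surjective B'.x
  obtain ⟨e, hsum⟩ := bil_of_level hA hB hAk hBk hx hy hpos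
  obtain ⟨hle, heq⟩ := cosh_add_le_bil hA' hB' hx' hy'
  have hxx : x ≤ x' := by rw [← Real.sinh_le_sinh, hx, hx']; exact hAA
  have hyy : y ≤ y' := by rw [← Real.sinh_le_sinh, hy, hy']; exact hBB
  have habs : Real.cosh (x + y) ≤ Real.cosh (x' + y') := by
    rw [Real.cosh_le_cosh, abs_of_pos hsum, abs_of_pos (by linarith)]; linarith
  rw [e]
  refine ⟨habs.trans hle, fun h => ?_⟩
  have h1 : Real.cosh (x + y) = Real.cosh (x' + y') := le_antisymm habs (hle.trans h.ge)
  have h2 : x' + y' ≤ x + y := by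
    have := h1.ge
    rwa [Real.cosh_le_cosh, abs_of_pos hsum, abs_of_pos (by linarith)] at this
  exact ⟨by rw [← hx, ← hx', le_antisymm hxx (by linarith)],
    by rw [← hy, ← hy', le_antisymm hyy (by linarith)], heq (h1.symm.trans h)⟩

/-! ### The arm lemma for convex chains -/

/-- Compatibility of the data of two chains with `n` edges: angles open, and edges grow only between
two obtuse turns and two edges of fixed length. -/
structure ChainOpens (n : ℕ) (l a l' a' : ℕ → ℝ) : Prop where
  nonneg : ∀ i, 0 < i → i < n → 0 ≤ a' i
  le : ∀ i, 0 < i → i < n → a' i ≤ a i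
  lt_pi : ∀ i, 0 < i → i < n → a i < Real.pi
  length_le : ∀ i < n, l i ≤ l' i
  grow : ∀ i < n, l i = l' i ∨ (0 < i ∧ i + 1 < n ∧ Real.pi / 2 ≤ a i ∧ Real.pi / 2 ≤ a' i ∧
    Real.pi / 2 ≤ a (i + 1) ∧ Real.pi / 2 ≤ a' (i + 1) ∧ l (i - 1) = l' (i - 1) ∧
    l (i + 1) = l' (i + 1))

/-- The consecutive vertices of a chain are in convex position, and the interior is on the left. -/
structure IsConvexChain (n : ℕ) (v : ℕ → LVec) (l a : ℕ → ℝ) : Prop extends IsChain n v l a where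
  det_nonneg : ∀ i j k, i < j → j < k → k ≤ n → 0 ≤ det (v i) (v j) (v k)
  ne : ∀ i j, i < j → j ≤ n → v i ≠ v j

/-- The first turn of the arm is only a share of the turn at the top vertex and may be acute; this
is why `ArmOpens` asks nothing of it when the first edge grows. -/
theorem ChainOpens.right {q m : ℕ} {l a l' a' : ℕ → ℝ} (h : ChainOpens (q + 1 + (m + 1)) l a l' a')
    (hl : ∀ i < q + 1 + (m + 1), 0 < l i) {s s' : ℝ} (h0 : 0 ≤ s') (h1 : s' ≤ s)
    (h2 : s < Real.pi) :
    ArmOpens (m + 1) (armAngles s fun i => a (q + 1 + i)) (fun i => l (q + 1 + i))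
      (armAngles s' fun i => a' (q + 1 + i)) (fun i => l' (q + 1 + i)) := by
  refine ⟨?_, ?_, ?_, fun i hi => hl _ (by omega), fun i hi => h.length_le _ (by omega), ?_⟩
  · rintro (_ | i) hi
    · exact h0
    · exact h.nonneg _ (by omega) (by omega)
  · rintro (_ | i) hi
    · exact h1
    · exact h.le _ (by omega) (by omega)
  · rintro (_ | i) hi
    · exact h2
    · exact h.lt_pi _ (by omega) (by omega)
  · intro i hi
    rcases h.grow (q + 1 + i) (by omega) with e | ⟨e1, e2, e3, e4, e5, e6, -, -⟩
    · exact Or.inl e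
    · refine Or.inr ⟨?_, by omega, e6⟩
      rcases i with _ | i
      · exact Or.inl rfl
      · exact Or.inr e3

theorem ChainOpens.left {q m : ℕ} {l a l' a' : ℕ → ℝ} (h : ChainOpens (q + 1 + (m + 1)) l a l' a')
    (hl : ∀ i < q + 1 + (m + 1), 0 < l i) {s s' : ℝ} (h0 : 0 ≤ s') (h1 : s' ≤ s)
    (h2 : s < Real.pi) :
    ArmOpens (q + 1) (armAngles s fun i => a (q + 1 - i)) (fun i => l (q - i))
      (armAngles s' fun i => a' (q + 1 - i)) (fun i => l' (q - i)) := by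
  refine ⟨?_, ?_, ?_, fun i hi => hl _ (by omega), fun i hi => h.length_le _ (by omega), ?_⟩
  · rintro (_ | i) hi
    · exact h0
    · exact h.nonneg _ (by omega) (by omega)
  · rintro (_ | i) hi
    · exact h1
    · exact h.le _ (by omega) (by omega)
  · rintro (_ | i) hi
    · exact h2
    · exact h.lt_pi _ (by omega) (by omega)
  · intro i hi
    rcases h.grow (q - i) (by omega) with e | ⟨e1, e2, e3, e4, e5, e6, -, -⟩
    · exact Or.inl e
    · rw [show q - i + 1 = q + 1 - i by omega] at e5
      have e7 : q + 1 - (i + 1) = q - i := by omega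
      refine Or.inr ⟨?_, by omega, by simpa [armAngles, e7] using e4⟩
      rcases i with _ | i
      · exact Or.inl rfl
      · exact Or.inr e5

theorem sin_pos_range {s : ℝ} (h1 : -Real.pi < s) (h2 : s ≤ Real.pi) (h : 0 < Real.sin s) :
    0 < s ∧ s < Real.pi := by
  constructor
  · by_contra! hle
    linarith [Real.sin_nonpos_of_nonpos_of_neg_pi_le hle h1.le]
  · refine lt_of_le_of_ne h2 ?_
    rintro rfl
    simp at h

/-- The arm lemma for a chain whose highest vertex is the base point. -/
theorem IsConvexChain.bil_le_of_highest {q m : ℕ} {v v' : ℕ → LVec} {l a l' a' : ℕ → ℝ}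
    {s k τ : ℝ} (h : IsConvexChain (q + 1 + (m + 1)) v l a)
    (h' : IsChain (q + 1 + (m + 1)) v' l' a') (hop : ChainOpens (q + 1 + (m + 1)) l a l' a')
    (hs : 0 < s) (hk : 0 < k) (ha : 0 ≤ a (q + 1))
    (hz : ∀ w, det (v 0) w (v (q + 1 + (m + 1))) = s * (k * w.t - w.y))
    (hv0 : v (q + 1) = origin)
    (hv1 : v (q + 1 + 1) = ⟨Real.cosh (l (q + 1)), Real.sinh (l (q + 1)) * Real.cos τ,
      Real.sinh (l (q + 1)) * Real.sin τ⟩)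
    (hτ1 : -Real.pi < τ) (hτ2 : τ ≤ Real.pi)
    (hhigh : ∀ i ≤ q + 1 + (m + 1), det (v 0) (v i) (v (q + 1 + (m + 1))) ≤ s * k) :
    bil (v 0) (v (q + 1 + (m + 1))) ≤ bil (v' 0) (v' (q + 1 + (m + 1))) ∧
      (bil (v 0) (v (q + 1 + (m + 1))) = bil (v' 0) (v' (q + 1 + (m + 1))) →
        (∀ i < q + 1 + (m + 1), l i = l' i) ∧ ∀ i, 0 < i → i < q + 1 + (m + 1) → a i = a' i) := by
  set n := q + 1 + (m + 1) with hn
  -- No vertex is higher than the base point, so any other one has `y > 0`. Applied to the two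
  -- neighbours, this places `τ` and `a (q + 1) - τ` strictly between 0 and π.
  have hypos : ∀ i ≤ n, 1 < (v i).t → 0 < (v i).y := by
    intro i hi ht
    have h1 := hhigh i hi
    rw [hz] at h1
    have h2 := le_of_mul_le_mul_left h1 hs
    have h3 := mul_pos hk (sub_pos.2 ht)
    linarith
  have hlr := h.pos (q + 1) (by omega)
  have hll := h.pos q (by omega)
  have hshr := Real.sinh_pos_iff.2 hlr
  have hshl := Real.sinh_pos_iff.2 hll
  have hsinr : 0 < Real.sin τ := by
    have h1 := hypos (q + 1 + 1) (by omega) (by rw [hv1]; exact Real.one_lt_cosh.2 hlr.ne')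
    rw [hv1] at h1
    exact pos_of_mul_pos_right h1 hshr.le
  obtain ⟨hτ0, hτpi⟩ := sin_pos_range hτ1 hτ2 hsinr
  have hqt : (v q).t = Real.cosh (l q) := by
    have := h.edge q (by omega)
    rw [hv0] at this
    simpa [bil, origin] using this
  have hapi := hop.lt_pi (q + 1) (by omega) (by omega)
  have hv2 : v q = ⟨Real.cosh (l q), -(Real.sinh (l q) * Real.cos (a (q + 1) - τ)),
      Real.sinh (l q) * Real.sin (a (q + 1) - τ)⟩ := by
    obtain ⟨t1, t2⟩ := h.turn q (by omega)
    rw [hv0, hv1] at t2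
    rw [show q + 2 = q + 1 + 1 from rfl, hv1] at t1
    simp only [bil, hqt] at t1
    simp only [det, origin] at t2
    have e1 : Real.sinh (l q) * Real.cos (a (q + 1))
        = -((v q).x * Real.cos τ + (v q).y * Real.sin τ) :=
      mul_left_cancel₀ hshr.ne' (by linarith)
    have e2 : Real.sinh (l q) * Real.sin (a (q + 1))
        = (v q).y * Real.cos τ - (v q).x * Real.sin τ :=
      mul_left_cancel₀ hshr.ne' (by linarith)
    have hτ := Real.sin_sq_add_cos_sq τ
    refine LVec.ext hqt ?_ ?_
    · simp only [Real.cos_sub]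
      linear_combination (-(v q).x) * hτ + Real.cos τ * e1 + Real.sin τ * e2
    · simp only [Real.sin_sub]
      linear_combination (-(v q).y) * hτ - Real.cos τ * e2 + Real.sin τ * e1
  have hsinl : 0 < Real.sin (a (q + 1) - τ) := by
    have h1 := hypos q (by omega) (by rw [hv2]; exact Real.one_lt_cosh.2 hll.ne')
    rw [hv2] at h1
    exact pos_of_mul_pos_right h1 hshl.le
  obtain ⟨hσ0, hσpi⟩ := sin_pos_range (by linarith) (by linarith) hsinl
  have ha'0 := hop.nonneg (q + 1) (by omega) (by omega)
  have ha'le := hop.le (q + 1) (by omega) (by omega)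
  -- The smaller turn is divided so that neither arm's share increases.
  obtain ⟨τ', hτ'0, hτ', hσ'0, hσ'⟩ : ∃ τ', 0 ≤ τ' ∧ τ' ≤ τ ∧ 0 ≤ a' (q + 1) - τ' ∧
      a' (q + 1) - τ' ≤ a (q + 1) - τ := by
    rcases le_total (a' (q + 1)) (a (q + 1) - τ) with hc | hc
    · exact ⟨0, le_rfl, hτ0.le, by linarith, by linarith⟩
    · exact ⟨a' (q + 1) - (a (q + 1) - τ), by linarith, by linarith, by linarith, by linarith⟩
  have hdzero : ∀ u w : LVec, det u u w = 0 ∧ det w u u = 0 := fun u w =>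
    ⟨by simp only [det]; ring, by simp only [det]; ring⟩
  have hlow : ∀ i ≤ n, 0 ≤ det (v 0) (v i) (v n) := by
    intro i hi
    rcases Nat.eq_zero_or_pos i with rfl | hpos
    · exact (hdzero _ _).1.ge
    rcases hi.eq_or_lt with rfl | hlt
    · exact (hdzero _ _).2.ge
    · exact h.det_nonneg _ _ _ hpos hlt le_rfl
  have hmir : ∀ x y w : LVec, det (mirror x) (mirror y) (mirror w) = det w y x := fun x y w => by
    simp only [det, mirror]; ring
  obtain ⟨hB, hBle, hBeq⟩ := arm_opens_le (z := v 0) (v := fun i => v (q + 1 + i))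
    (h.toIsChain.drop.congr_angle (b := armAngles τ fun i => a (q + 1 + i)) fun i => rfl) hv0 hv1 hτ0
    (hop.right h.pos hτ'0 hτ' hτpi) hs hk hz (fun i hi => hlow _ (by omega))
    (fun i hi => hhigh _ (by omega)) (fun i j m hij hjm hm => h.det_nonneg _ _ _ (by omega)
      (by omega) (by omega)) (fun i j hij hj => h.det_nonneg _ _ _ (by omega) (by omega) (by omega))
    (fun i j hij hj => h.ne _ _ (by omega) (by omega))
  have hleft : IsChain (q + 1) (fun i => mirror (v (q + 1 - i))) (fun i => l (q - i))
      (armAngles (a (q + 1) - τ) fun i => a (q + 1 - i)) :=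
    ((h.toIsChain.take (m := q + 1) (by omega)).reverse).congr_angle fun i => rfl
  have hend : mirror (v (q + 1 - (q + 1))) = mirror (v 0) := by rw [Nat.sub_self]
  obtain ⟨hA, hAle, hAeq⟩ := arm_opens_le (z := mirror (v n)) hleft
    (by simp only [tsub_zero, hv0, mirror, origin, neg_zero])
    (by simp only [add_tsub_cancel_right, tsub_zero, hv2, mirror, neg_neg]; rfl) hσ0
    (hop.left h.pos hσ'0 hσ' hσpi) hs hk
    (fun w => by
      have e : w = mirror (mirror w) := by simp [mirror]
      rw [hend, e, hmir, hz, ← e]; rfl)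
    (fun i hi => by rw [hend, hmir]; exact hlow _ (by omega))
    (fun i hi => by rw [hend, hmir]; exact hhigh _ (by omega))
    (fun i j m hij hjm hm => by
      rw [hmir]; exact h.det_nonneg _ _ _ (by omega) (by omega) (by omega))
    (fun i j hij hj => by
      rw [hmir]
      rcases (show q + 1 - i ≤ n by omega).eq_or_lt with e | e
      · omega
      · exact h.det_nonneg _ _ _ (by omega) e le_rfl)
    (fun i j hij hj e => by
      have e2 : v (q + 1 - j) = v (q + 1 - i) := by
        have := congrArg mirror e
        simpa [mirror, LVec.ext_iff] using this.symm
      exact h.ne _ _ (by omega) (by omega) e2)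
  rw [hend] at hA hAle hAeq
  obtain ⟨A, B, eA, eB, e1⟩ := h.toIsChain.bil_eq_of_split (s := a (q + 1) - τ) (s' := τ) (by ring)
  obtain ⟨A', B', eA', eB', e2⟩ := h'.bil_eq_of_split (s := a' (q + 1) - τ') (s' := τ') (by ring)
  rw [← eB'] at hBle hBeq
  rw [← eA'] at hAle hAeq
  rw [← eB] at hB
  rw [← eA] at hA
  rw [hB] at hBle hBeq
  rw [hA] at hAle hAeq
  have sA' : OnSheet A' := eA' ▸ onSheet_endpt _ _ _
  have sB' : OnSheet B' := eB' ▸ onSheet_endpt _ _ _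
  have sA : OnSheet A := eA ▸ onSheet_endpt _ _ _
  have sB : OnSheet B := eB ▸ onSheet_endpt _ _ _
  have hlev : ∀ w, det (v 0) w (v n) = 0 → w.y = k * w.t := by
    intro w hw
    rw [hz] at hw
    have := (mul_eq_zero.1 hw).resolve_left hs.ne'
    linarith
  have hB' : v n = B := hB
  have hBk : B.y = k * B.t := hB' ▸ hlev _ (hdzero _ _).2
  have hAk : A.y = k * A.t := by
    rw [← hA]; exact hlev (v 0) (hdzero _ _).1
  have hpos : 0 < A.x * B.t + A.t * B.x := by
    have e := hz origin
    have eA0 : v 0 = mirror A := by rw [← hA]; simp [mirror]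
    have e3 : det (v 0) origin (v n) = k * (A.x * B.t + A.t * B.x) := by
      rw [eA0, hB']
      simp only [det, mirror, origin, hAk, hBk]; ring
    rw [e3] at e
    simp only [origin] at e
    have : 0 < k * (A.x * B.t + A.t * B.x) := by rw [e]; simpa using mul_pos hs hk
    exact pos_of_mul_pos_right this hk.le
  obtain ⟨hle, heq⟩ := bil_arms_le sA sB sA' sB' hAk hBk hpos hAle hBle
  have e1' : bil (v 0) (v n) = A.t * B.t + A.x * B.x - A.y * B.y := e1
  have e2' : bil (v' 0) (v' n) = A'.t * B'.t + A'.x * B'.x - A'.y * B'.y := e2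
  rw [e1', e2']
  refine ⟨hle, fun hE => ?_⟩
  obtain ⟨f1, f2, f3⟩ := heq hE
  -- Equality requires both free ends to have the same foot on the axis. This fails if one arm is
  -- unchanged, with foot at level `k`, and the other has passed that level.
  have hcase : ∀ X X' : LVec, X'.t * X.y = X'.y * X.t → 0 < X.t → k * X'.t < X'.y →
      X.y = k * X.t → False := by
    intro X X' g1 g2 g3 g4
    rw [g4] at g1
    have := mul_lt_mul_of_pos_right g3 g2
    linarith
  rcases hAeq f1 with gA | ⟨gA1, gA2⟩
  · have hAA : A' = A := by
      rw [eA, eA']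
      exact endpt_congr (fun i hi => (gA i hi).1.symm) (fun i hi => (gA i hi).2.symm)
    rcases hBeq f2 with gB | ⟨gB1, gB2⟩
    · have hτeq : τ = τ' := (gB 0 (by omega)).1
      have hσeq : a (q + 1) - τ = a' (q + 1) - τ' := (gA 0 (by omega)).1
      constructor
      · intro i hi
        rcases lt_or_ge i (q + 1) with hlt | hge
        · have := (gA (q - i) (by omega)).2
          simpa [show q - (q - i) = i by omega] using this
        · have := (gB (i - (q + 1)) (by omega)).2
          simpa [show q + 1 + (i - (q + 1)) = i by omega] using this
      · intro i hi0 hi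
        rcases lt_trichotomy i (q + 1) with hlt | heq | hgt
        · have := (gA (q + 1 - i) (by omega)).1
          simpa [armAngles, show q + 1 - (q + 1 - i) = i by omega,
            show q + 1 - i ≠ 0 by omega] using this
        · rw [heq]; linarith
        · have := (gB (i - (q + 1)) (by omega)).1
          simpa [armAngles, show q + 1 + (i - (q + 1)) = i by omega,
            show i - (q + 1) ≠ 0 by omega] using this
    · exfalso
      rw [hAA] at f3
      exact hcase A B' (by linarith) sA.1 gB2 hAk
  · rcases hBeq f2 with gB | ⟨gB1, gB2⟩
    · exfalso
      have hBB : B' = B := by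
        rw [eB, eB']
        exact endpt_congr (fun i hi => (gB i hi).1.symm) (fun i hi => (gB i hi).2.symm)
      rw [hBB] at f3
      exact hcase B A' f3 sB.1 gA2 hBk
    -- The first edges of the two arms are adjacent, so they cannot both grow.
    · exfalso
      rcases hop.grow (q + 1) (by omega) with e | ⟨-, -, -, -, -, -, e, -⟩
      · exact gB1 e
      · exact gA1 e

theorem det_eq_zero_of_coplanar {u w x y z : LVec} (hu : OnSheet u) (hw : OnSheet w) (huw : u ≠ w)
    (hx : det u x w = 0) (hy : det u y w = 0) (hz : det u z w = 0) : det x y z = 0 := by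
  by_contra hne
  have e1 : det x y z * (u.t * w.y - u.y * w.t) = 0 := by
    have : det x y z * (u.t * w.y - u.y * w.t)
        = -(y.t * z.y - y.y * z.t) * det u x w + (x.t * z.y - x.y * z.t) * det u y w
          - (x.t * y.y - x.y * y.t) * det u z w := by simp only [det]; ring
    rw [this, hx, hy, hz]; ring
  have e2 : det x y z * (u.t * w.x - u.x * w.t) = 0 := by
    have : det x y z * (u.t * w.x - u.x * w.t)
        = -(y.t * z.x - y.x * z.t) * det u x w + (x.t * z.x - x.x * z.t) * det u y w
          - (x.t * y.x - x.x * y.t) * det u z w := by simp only [det]; ring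
    rw [this, hx, hy, hz]; ring
  have f1 := (mul_eq_zero.1 e1).resolve_left hne
  have f2 := (mul_eq_zero.1 e2).resolve_left hne
  exact huw (hu.eq_of_proportional hw (by linarith) (by linarith))

theorem coord_self {p q : LVec} {l : ℝ} (hp : OnSheet p) (h : bil p q = Real.cosh l) :
    coord p q l p = origin := by
  have e : det p q p = 0 := by simp only [det]; ring
  simp [coord, origin, hp.2, e, bil_comm q p, h]

theorem coord_next {p q : LVec} {l : ℝ} (hq : OnSheet q) (hl : 0 < l)
    (h : bil p q = Real.cosh l) : coord p q l q = ⟨Real.cosh l, Real.sinh l, 0⟩ := by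
  have hs := (Real.sinh_pos_iff.2 hl).ne'
  have e : det p q q = 0 := by simp only [det]; ring
  ext
  · simp [coord, h]
  · simp only [coord, h, hq.2]
    field_simp
    linear_combination Real.cosh_sq l
  · simp [coord, e]

theorem OnSheet.coord {p q v : LVec} {l : ℝ} (hp : OnSheet p) (hq : OnSheet q) (hl : 0 < l)
    (h : bil p q = Real.cosh l) (hv : OnSheet v) : OnSheet (coord p q l v) :=
  ⟨lt_of_lt_of_le one_pos (hp.one_le_bil hv), by rw [bil_coord hp hq hl h]; exact hv.2⟩

theorem rot_rot_neg (a : ℝ) (v : LVec) : rot a (rot (-a) v) = v := by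
  have h := Real.sin_sq_add_cos_sq a
  ext <;> simp only [rot, Real.cos_neg, Real.sin_neg]
  · linear_combination v.x * h
  · linear_combination v.y * h

/-- A linear functional that vanishes at two points is, after a rotation, independent of the first
spatial coordinate. -/
theorem exists_rot_det (u w : LVec) :
    ∃ s τ c : ℝ, 0 ≤ s ∧ -Real.pi < τ ∧ τ ≤ Real.pi ∧
      ∀ x, det (rot τ u) x (rot τ w) = c * x.t - s * x.y := by
  set ζ : ℂ := ⟨u.t * w.x - u.x * w.t, -(u.t * w.y - u.y * w.t)⟩ with hζ
  refine ⟨‖ζ‖, ζ.arg, -(u.x * w.y - u.y * w.x), norm_nonneg _, Complex.neg_pi_lt_arg _,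
    Complex.arg_le_pi _, fun x => ?_⟩
  have h1 : ‖ζ‖ * Real.cos ζ.arg = u.t * w.x - u.x * w.t := Complex.norm_mul_cos_arg ζ
  have h2 : ‖ζ‖ * Real.sin ζ.arg = -(u.t * w.y - u.y * w.t) := Complex.norm_mul_sin_arg ζ
  have h3 := Real.sin_sq_add_cos_sq ζ.arg
  conv_lhs => rw [← rot_rot_neg ζ.arg x]
  rw [det_rot]
  simp only [det, rot, Real.cos_neg, Real.sin_neg]
  linear_combination (x.y * ‖ζ‖) * (-h3)
    + (-(x.x * Real.sin ζ.arg) + x.y * Real.cos ζ.arg) * h1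
    + (x.x * Real.cos ζ.arg + x.y * Real.sin ζ.arg) * h2

/-- The arm lemma for convex chains. -/
theorem IsConvexChain.bil_le {n : ℕ} {v v' : ℕ → LVec} {l a l' a' : ℕ → ℝ}
    (h : IsConvexChain (n + 1) v l a) (h' : IsChain (n + 1) v' l' a')
    (hop : ChainOpens (n + 1) l a l' a') :
    bil (v 0) (v (n + 1)) ≤ bil (v' 0) (v' (n + 1)) ∧
      (bil (v 0) (v (n + 1)) = bil (v' 0) (v' (n + 1)) →
        (∀ i < n + 1, l i = l' i) ∧ ∀ i, 0 < i → i < n + 1 → a i = a' i) := by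
  have hdzero : ∀ u w : LVec, det u u w = 0 ∧ det w u u = 0 := fun u w =>
    ⟨by simp only [det]; ring, by simp only [det]; ring⟩
  -- The determinant is a positive multiple of the hyperbolic sine of the signed distance from the
  -- line through the free vertices, so its maximum is a highest vertex.
  obtain ⟨q, hq, hmax⟩ := Finset.exists_max_image (Finset.range (n + 2))
    (fun i => det (v 0) (v i) (v (n + 1))) ⟨0, by simp⟩
  simp only [Finset.mem_range] at hq hmax
  -- If no vertex is off the line, all turns vanish, so they cannot decrease further, and no edge is
  -- allowed to grow: the chain is rigid.
  rcases le_or_gt (det (v 0) (v q) (v (n + 1))) 0 with hle | hpos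
  · have hline : ∀ i ≤ n + 1, det (v 0) (v i) (v (n + 1)) = 0 := by
      intro i hi
      refine le_antisymm ((hmax i (by omega)).trans hle) ?_
      rcases Nat.eq_zero_or_pos i with rfl | hi0
      · exact (hdzero _ _).1.ge
      rcases hi.eq_or_lt with rfl | hlt
      · exact (hdzero _ _).2.ge
      · exact h.det_nonneg _ _ _ hi0 hlt le_rfl
    have ha : ∀ i, 0 < i → i < n + 1 → a i = 0 := by
      intro i hi0 hi
      obtain ⟨i, rfl⟩ : ∃ j, i = j + 1 := ⟨i - 1, by omega⟩
      have h1 := (h.turn i (by omega)).2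
      rw [det_eq_zero_of_coplanar (h.sheet 0 (by omega)) (h.sheet (n + 1) le_rfl)
        (h.ne 0 (n + 1) (by omega) le_rfl) (hline i (by omega)) (hline (i + 1) (by omega))
        (hline (i + 2) (by omega))] at h1
      have p1 := Real.sinh_pos_iff.2 (h.pos i (by omega))
      have p2 := Real.sinh_pos_iff.2 (h.pos (i + 1) (by omega))
      have hsin := (mul_eq_zero.1 h1).resolve_left (mul_pos p1 p2).ne'
      by_contra hne
      have h2 := hop.nonneg (i + 1) hi0 hi
      have h3 := hop.le (i + 1) hi0 hi
      exact (Real.sin_pos_of_pos_of_lt_pi (lt_of_le_of_ne (h2.trans h3) (Ne.symm hne))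
        (hop.lt_pi _ hi0 hi)).ne' hsin
    have ha' : ∀ i, 0 < i → i < n + 1 → a i = a' i := by
      intro i hi0 hi
      have h1 := hop.le i hi0 hi
      rw [ha i hi0 hi] at h1 ⊢
      exact le_antisymm (hop.nonneg i hi0 hi) h1
    have hl : ∀ i < n + 1, l i = l' i := by
      intro i hi
      rcases hop.grow i hi with e | ⟨e1, -, e2, -⟩
      · exact e
      · rw [ha i e1 hi] at e2
        linarith [Real.pi_pos]
    exact ⟨(h.toIsChain.bil_eq_bil h' hl fun i hi => ha' _ (by omega) (by omega)).le,
      fun _ => ⟨hl, ha'⟩⟩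
  · have hq0 : q ≠ 0 := by
      rintro rfl
      rw [(hdzero _ _).1] at hpos
      exact lt_irrefl _ hpos
    have hqn : q ≠ n + 1 := by
      rintro rfl
      rw [(hdzero _ _).2] at hpos
      exact lt_irrefl _ hpos
    obtain ⟨q, rfl⟩ : ∃ j, q = j + 1 := ⟨q - 1, by omega⟩
    obtain ⟨m, rfl⟩ : ∃ m, n = q + 1 + m := ⟨n - (q + 1), by omega⟩
    have hp := h.sheet (q + 1) (by omega)
    have hr := h.sheet (q + 1 + 1) (by omega)
    have hl := h.pos (q + 1) (by omega)
    have he := h.edge (q + 1) (by omega)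
    set C := coord (v (q + 1)) (v (q + 1 + 1)) (l (q + 1)) with hC
    -- The rotation makes the second axis perpendicular to the line through the free vertices; the
    -- height function then has the form `c * t - s * y`.
    obtain ⟨s, τ, c, hs, hτ1, hτ2, hdet⟩ := exists_rot_det (C (v 0)) (C (v (q + 1 + (m + 1))))
    have hfb : ∀ u w, bil (rot τ (C u)) (rot τ (C w)) = bil u w := fun u w => by
      rw [bil_rot, bil_coord hp hr hl he]
    have hfd : ∀ u w x, det (rot τ (C u)) (rot τ (C w)) (rot τ (C x)) = det u w x :=
      fun u w x => by rw [det_rot, det_coord hp hr hl he]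
    have hfs : ∀ i ≤ q + 1 + (m + 1), OnSheet (rot τ (C (v i))) := fun i hi =>
      (hp.coord hr hl he (h.sheet i hi)).rot τ
    have h0 : rot τ (C (v (q + 1))) = origin := by
      rw [hC, coord_self hp he]
      simp [rot, origin]
    have h1 : rot τ (C (v (q + 1 + 1))) = ⟨Real.cosh (l (q + 1)), Real.sinh (l (q + 1)) * Real.cos τ,
        Real.sinh (l (q + 1)) * Real.sin τ⟩ := by
      rw [hC, coord_next hr hl he]
      ext <;> simp [rot, mul_comm]
    have hc : c = det (v 0) (v (q + 1)) (v (q + 1 + (m + 1))) := by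
      rw [← hfd, h0, hdet]
      simp [origin]
    have hcpos : 0 < c := hc ▸ hpos
    have hs0 : 0 < s := by
      refine lt_of_le_of_ne hs ?_
      rintro rfl
      have e := hdet (rot τ (C (v (q + 1 + (m + 1)))))
      rw [(hdzero _ _).2, zero_mul, sub_zero] at e
      exact (mul_pos hcpos (hfs _ le_rfl).1).ne e
    have hW : IsConvexChain (q + 1 + (m + 1)) (fun i => rot τ (C (v i))) l a :=
      { toIsChain := h.toIsChain.map (fun x => rot τ (C x)) hfs hfb hfd
        det_nonneg := fun i j k hij hjk hk => by rw [hfd]; exact h.det_nonneg i j k hij hjk hk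
        ne := fun i j hij hj e => h.ne i j hij hj (by
          refine (h.sheet i (by omega)).eq_of_bil_eq_one (h.sheet j (by omega)) ?_
          rw [← hfb, e]
          exact (hfs j hj).2) }
    have key := hW.bil_le_of_highest h' hop (s := s) (k := c / s) (τ := τ) hs0 (div_pos hcpos hs0)
      ((hop.nonneg _ (by omega) (by omega)).trans (hop.le _ (by omega) (by omega)))
      (fun w => by rw [hdet]; field_simp) h0 h1 hτ1 hτ2
      (fun i hi => by
        rw [hfd, mul_div_cancel₀ _ hs0.ne', hc]
        exact hmax i (by omega))
    simp only [hfb] at key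
    exact key

end LVec

/-! ### From the upper half-plane to the hyperboloid -/

namespace UpperHalfPlane

/-- The point of the hyperboloid that corresponds to a point of the upper half-plane. -/
def toLVec (z : UpperHalfPlane) : LVec :=
  ⟨(z.re ^ 2 + z.im ^ 2 + 1) / (2 * z.im), (z.re ^ 2 + z.im ^ 2 - 1) / (2 * z.im), -(z.re / z.im)⟩

theorem onSheet_toLVec (z : UpperHalfPlane) : LVec.OnSheet z.toLVec := by
  have h := z.im_pos
  constructor
  · simp only [toLVec]; positivity
  · simp only [toLVec, LVec.bil]
    field_simp
    ring

theorem bil_toLVec (z w : UpperHalfPlane) :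
    LVec.bil z.toLVec w.toLVec = Real.cosh (dist z w) := by
  have hz := z.im_pos
  have hw := w.im_pos
  have e : dist (z : ℂ) w ^ 2 = (z.re - w.re) ^ 2 + (z.im - w.im) ^ 2 := by
    rw [Complex.dist_eq, ← Complex.normSq_eq_norm_sq, Complex.normSq_apply]
    simp only [Complex.sub_re, Complex.sub_im, coe_re, coe_im]
    ring
  rw [cosh_dist, e]
  simp only [toLVec, LVec.bil]
  field_simp
  ring

theorem toLVec_injective : Function.Injective toLVec := by
  intro z w h
  have h1 := bil_toLVec z w
  rw [h, (onSheet_toLVec w).2] at h1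
  by_contra hne
  exact (Real.one_lt_cosh.2 (dist_pos.2 hne).ne').ne h1

/-- The direction from `p` to `q`, rescaled. -/
theorem hypDir_eq (p q : UpperHalfPlane) :
    hypDir p q = ((LVec.bil p.toLVec q.toLVec + 1)⁻¹ : ℝ) *
      (⟨((q.re - p.re) ^ 2 + q.im ^ 2 - p.im ^ 2) / (2 * p.im * q.im),
        (p.re - q.re) / q.im⟩ : ℂ) := by
  have hp := p.im_pos
  have hq := q.im_pos
  have hne : (q : ℂ) - (starRingEnd ℂ) (p : ℂ) ≠ 0 := by
    intro h
    have := congrArg Complex.im h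
    simp at this
    linarith
  have hb : LVec.bil p.toLVec q.toLVec + 1
      = ((q.re - p.re) ^ 2 + (q.im + p.im) ^ 2) / (2 * p.im * q.im) := by
    simp only [toLVec, LVec.bil]
    field_simp
    ring
  have hD : (q.re - p.re) ^ 2 + (q.im + p.im) ^ 2 ≠ 0 := by positivity
  have hs : (LVec.bil p.toLVec q.toLVec + 1)⁻¹ * ((q.re - p.re) ^ 2 + (q.im + p.im) ^ 2)
      = 2 * p.im * q.im := by
    rw [hb]; field_simp
  rw [hypDir, div_eq_iff hne, mul_assoc]
  generalize (LVec.bil p.toLVec q.toLVec + 1)⁻¹ = s at hs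
  apply Complex.ext
  · rw [Complex.re_ofReal_mul]
    simp
    field_simp
    linear_combination (p.re - q.re) * hs
  · rw [Complex.im_ofReal_mul]
    simp
    field_simp
    linear_combination (p.im - q.im) * hs

/-- One complex number carries both invariants of a triangle: up to a positive factor its real part
gives the law of cosines and its imaginary part the orientation. -/
theorem conj_hypDir_mul (p q r : UpperHalfPlane) :
    (starRingEnd ℂ) (hypDir p q) * hypDir p r
      = (((LVec.bil p.toLVec q.toLVec + 1)⁻¹ * (LVec.bil p.toLVec r.toLVec + 1)⁻¹ : ℝ) : ℂ) *
        (⟨LVec.bil p.toLVec q.toLVec * LVec.bil p.toLVec r.toLVec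
            - LVec.bil q.toLVec r.toLVec, LVec.det p.toLVec q.toLVec r.toLVec⟩ : ℂ) := by
  have hp := p.im_pos
  have hq := q.im_pos
  have hr := r.im_pos
  rw [hypDir_eq, hypDir_eq]
  generalize (LVec.bil p.toLVec q.toLVec + 1)⁻¹ = s
  generalize (LVec.bil p.toLVec r.toLVec + 1)⁻¹ = t
  rw [map_mul, Complex.conj_ofReal, Complex.ofReal_mul, mul_mul_mul_comm]
  congr 1
  apply Complex.ext
  · simp [toLVec, LVec.bil]
    field_simp
    ring
  · simp [toLVec, LVec.det]
    field_simp
    ring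

theorem bil_add_one_pos (p q : UpperHalfPlane) : 0 < LVec.bil p.toLVec q.toLVec + 1 := by
  linarith [(onSheet_toLVec p).one_le_bil (onSheet_toLVec q)]

theorem hypOrient_eq (p q r : UpperHalfPlane) :
    hypOrient p q r = (LVec.bil p.toLVec q.toLVec + 1)⁻¹ * (LVec.bil p.toLVec r.toLVec + 1)⁻¹ *
      LVec.det p.toLVec q.toLVec r.toLVec := by
  rw [hypOrient, conj_hypDir_mul, Complex.im_ofReal_mul]

theorem hypOrient_nonneg_iff (p q r : UpperHalfPlane) :
    0 ≤ hypOrient p q r ↔ 0 ≤ LVec.det p.toLVec q.toLVec r.toLVec := by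
  rw [hypOrient_eq]
  exact mul_nonneg_iff_of_pos_left
    (mul_pos (inv_pos.2 (bil_add_one_pos p q)) (inv_pos.2 (bil_add_one_pos p r)))

theorem norm_hypDir (p q : UpperHalfPlane) :
    ‖hypDir p q‖ = (LVec.bil p.toLVec q.toLVec + 1)⁻¹ * Real.sinh (dist p q) := by
  have h := congrArg Complex.re (conj_hypDir_mul p q q)
  rw [Complex.re_ofReal_mul, (onSheet_toLVec q).2, ← Complex.normSq_eq_conj_mul_self,
    Complex.ofReal_re, Complex.normSq_eq_norm_sq] at h
  have h1 := Real.cosh_sq (dist p q)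
  rw [← bil_toLVec] at h1
  have h2 : 0 ≤ (LVec.bil p.toLVec q.toLVec + 1)⁻¹ * Real.sinh (dist p q) :=
    mul_nonneg (inv_pos.2 (bil_add_one_pos p q)).le (Real.sinh_nonneg_iff.2 dist_nonneg)
  refine (pow_left_inj₀ (norm_nonneg _) h2 two_ne_zero).1 ?_
  rw [h, mul_pow, eq_sub_iff_add_eq.2 h1.symm]
  simp only
  ring

/-- The hyperbolic law of cosines. -/
theorem sinh_mul_sinh_mul_cos_hypAngle {p q r : UpperHalfPlane} (hp : p ≠ q) (hr : r ≠ q) :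
    Real.sinh (dist p q) * Real.sinh (dist q r) * Real.cos (hypAngle p q r)
      = Real.cosh (dist p q) * Real.cosh (dist q r) - LVec.bil p.toLVec r.toLVec := by
  have h1 := Real.sinh_pos_iff.2 (dist_pos.2 hp)
  have h2 := Real.sinh_pos_iff.2 (dist_pos.2 hr)
  have h3 := (bil_add_one_pos q p).ne'
  have h4 := (bil_add_one_pos q r).ne'
  have h5 : inner ℝ (hypDir q p) (hypDir q r)
      = ((starRingEnd ℂ) (hypDir q p) * hypDir q r).re := by
    rw [mul_comm]; rfl
  rw [dist_comm q r, hypAngle, InnerProductGeometry.cos_angle, h5, conj_hypDir_mul,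
    Complex.re_ofReal_mul, norm_hypDir, norm_hypDir, dist_comm q p, dist_comm q r,
    ← bil_toLVec p q, ← bil_toLVec r q, LVec.bil_comm p.toLVec q.toLVec,
    LVec.bil_comm r.toLVec q.toLVec]
  field_simp

/-- A broken geodesic that turns left turns by the exterior angle. -/
theorem turn_toLVec {p q r : UpperHalfPlane} (hp : p ≠ q) (hr : r ≠ q)
    (h : 0 ≤ LVec.det p.toLVec q.toLVec r.toLVec) :
    LVec.Turn p.toLVec q.toLVec r.toLVec (dist p q) (dist q r) (Real.pi - hypAngle p q r) := by
  have hc := sinh_mul_sinh_mul_cos_hypAngle hp hr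
  have h1 := Real.sinh_pos_iff.2 (dist_pos.2 hp)
  have h2 : 0 < Real.sinh (dist q r) := Real.sinh_pos_iff.2 (dist_pos.2 hr.symm)
  refine ⟨by rw [Real.cos_pi_sub]; linarith, ?_⟩
  rw [Real.sin_pi_sub]
  have hs : 0 ≤ Real.sin (hypAngle p q r) := InnerProductGeometry.sin_angle_nonneg _ _
  refine (pow_left_inj₀ (mul_nonneg (mul_pos h1 h2).le hs) h two_ne_zero).1 ?_
  -- The squared determinant is a Gram determinant, which the law of cosines identifies with the
  -- square of the left side; both bases are nonnegative.
  have hd := LVec.det_mul_det p.toLVec q.toLVec r.toLVec p.toLVec q.toLVec r.toLVec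
  rw [(onSheet_toLVec p).2, (onSheet_toLVec q).2, (onSheet_toLVec r).2,
    LVec.bil_comm q.toLVec p.toLVec, LVec.bil_comm r.toLVec p.toLVec,
    LVec.bil_comm r.toLVec q.toLVec, bil_toLVec p q, bil_toLVec q r] at hd
  rw [sq (LVec.det _ _ _), hd, mul_pow, Real.sin_sq]
  have hc2 := congrArg (fun t => t ^ 2) hc
  simp only [mul_pow] at hc2
  rw [mul_sub, mul_one, mul_pow, hc2, Real.sinh_sq, Real.sinh_sq]
  ring

end UpperHalfPlane

open UpperHalfPlane

/-! ### Convex polygons and their subchains -/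

namespace IsConvexHypPolygon

variable {m : ℕ} {v : ZMod m → UpperHalfPlane}

/-- In a convex polygon, three vertices in cyclic order starting anywhere are in counterclockwise
order. -/
theorem det_nonneg (h : IsConvexHypPolygon m v) (s : ZMod m) {i j k : ℕ} (hij : i < j) (hjk : j < k)
    (hk : k < m) :
    0 ≤ LVec.det (v (s + (i : ZMod m))).toLVec (v (s + (j : ZMod m))).toLVec
      (v (s + (k : ZMod m))).toLVec := by
  have : NeZero m := ⟨by have := h.three_le; omega⟩
  have hs := ZMod.val_lt s
  have hval : ∀ i < m, (s + (i : ZMod m)).val = if s.val + i < m then s.val + i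
      else s.val + i - m := by
    intro i hi
    rw [ZMod.val_add, ZMod.val_natCast, Nat.mod_eq_of_lt hi]
    split_ifs with hc
    · exact Nat.mod_eq_of_lt hc
    · rw [Nat.mod_eq_sub_mod (by omega), Nat.mod_eq_of_lt (by omega)]
  have vi := hval i (by omega)
  have vj := hval j (by omega)
  have vk := hval k hk
  have key := fun a b c h1 h2 => (hypOrient_nonneg_iff _ _ _).1 (h.orient_nonneg a b c h1 h2)
  -- The indices that wrap past `m` become the smallest ones; a cyclic rotation of the determinant
  -- restores the increasing order.
  by_cases ck : s.val + k < m
  · rw [if_pos (by omega)] at vi vj vk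
    exact key _ _ _ (by omega) (by omega)
  rw [if_neg ck] at vk
  by_cases cj : s.val + j < m
  · rw [if_pos (by omega)] at vi vj
    rw [LVec.det_rotate, LVec.det_rotate]
    exact key _ _ _ (by omega) (by omega)
  rw [if_neg cj] at vj
  by_cases ci : s.val + i < m
  · rw [if_pos ci] at vi
    rw [LVec.det_rotate]
    exact key _ _ _ (by omega) (by omega)
  · rw [if_neg ci] at vi
    exact key _ _ _ (by omega) (by omega)

theorem ne (h : IsConvexHypPolygon m v) (s : ZMod m) {i j : ℕ} (hij : i < j) (hj : j < m) :
    v (s + (i : ZMod m)) ≠ v (s + (j : ZMod m)) := by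
  intro e
  have e2 := add_left_cancel (h.injective e)
  rw [ZMod.natCast_eq_natCast_iff, Nat.ModEq, Nat.mod_eq_of_lt (by omega), Nat.mod_eq_of_lt hj] at e2
  omega

/-- The angles of a convex polygon are positive. -/
theorem hypAngle_ne_zero (h : IsConvexHypPolygon m v) (s : ZMod m) :
    hypAngle (v s) (v (s + 1)) (v (s + 2)) ≠ 0 := by
  have h3 := h.three_le
  have : NeZero m := ⟨by omega⟩
  have e0 : s + ((0 : ℕ) : ZMod m) = s := by simp
  have e1 : s + ((1 : ℕ) : ZMod m) = s + 1 := by simp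
  have e2 : s + ((2 : ℕ) : ZMod m) = s + 2 := by simp
  intro hang
  have hne := h.ne s (i := 0) (j := 1) (by omega) (by omega)
  rw [e0, e1] at hne
  obtain ⟨-, r, hr, hdir⟩ := InnerProductGeometry.angle_eq_zero_iff.1 hang
  have hor : ∀ x, hypOrient (v (s + 1)) (v (s + 2)) x = r * hypOrient (v (s + 1)) (v s) x := by
    intro x
    rw [hypOrient, hypOrient, hdir, Complex.real_smul, map_mul, Complex.conj_ofReal, mul_assoc,
      Complex.im_ofReal_mul]
  -- At angle zero, `v s` and `v (s + 2)` lie in the same direction from `v (s + 1)`. The polygon is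
  -- to the left of both consecutive edges, hence on both sides of one line, hence in that line.
  have hline : ∀ x, LVec.det (v (s + 1)).toLVec (v x).toLVec (v s).toLVec = 0 := by
    intro x
    obtain ⟨i, hi, rfl⟩ : ∃ i : ℕ, i < m ∧ x = s + (i : ZMod m) :=
      ⟨(x - s).val, ZMod.val_lt _, by simp⟩
    have hswap : LVec.det (v (s + 1)).toLVec (v (s + (i : ZMod m))).toLVec (v s).toLVec
        = LVec.det (v s).toLVec (v (s + 1)).toLVec (v (s + (i : ZMod m))).toLVec := by
      rw [← LVec.det_rotate]
    rcases Nat.lt_or_ge i 2 with hlt | hge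
    · interval_cases i
      · rw [e0]; simp only [LVec.det]; ring
      · rw [e1]; simp only [LVec.det]; ring
    have h1 := h.det_nonneg s (i := 0) (j := 1) (k := i) (by omega) (by omega) hi
    rw [e0, e1] at h1
    refine le_antisymm ?_ (hswap ▸ h1)
    have h2 : 0 ≤ hypOrient (v (s + 1)) (v (s + 2)) (v (s + (i : ZMod m))) := by
      rw [hypOrient_nonneg_iff]
      rcases hge.eq_or_lt with h2 | h2
      · rw [← h2, e2]
        apply ge_of_eq
        simp only [LVec.det]; ring
      · have := h.det_nonneg s (i := 1) (j := 2) (k := i) (by omega) h2 hi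
        rwa [e1, e2] at this
    rw [hor] at h2
    have h4 := (hypOrient_nonneg_iff _ _ _).1 (nonneg_of_mul_nonneg_right h2 hr)
    rw [hswap, LVec.det_swap]
    linarith
  obtain ⟨i, j, k, hijk⟩ := h.nondegenerate
  refine hijk ?_
  rw [hypOrient_eq, LVec.det_eq_zero_of_coplanar (onSheet_toLVec _) (onSheet_toLVec _)
    (fun e => hne (toLVec_injective e).symm) (hline i) (hline j) (hline k), mul_zero]

/-- Fewer than `m` consecutive edges of a convex polygon form a convex chain. -/
theorem isConvexChain (h : IsConvexHypPolygon m v) (s : ZMod m) {n : ℕ} (hn : n < m) :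
    LVec.IsConvexChain n (fun i => (v (s + (i : ZMod m))).toLVec)
      (fun i => dist (v (s + (i : ZMod m))) (v (s + ((i + 1 : ℕ) : ZMod m))))
      (fun i => Real.pi - hypAngle (v (s + ((i - 1 : ℕ) : ZMod m))) (v (s + (i : ZMod m)))
        (v (s + ((i + 1 : ℕ) : ZMod m)))) where
  sheet _ _ := onSheet_toLVec _
  pos i hi := dist_pos.2 (h.ne s (by omega) (by omega))
  edge i hi := bil_toLVec _ _
  turn i hi := turn_toLVec (h.ne s (by omega) (by omega)) (h.ne s (by omega) (by omega)).symm
    (h.det_nonneg s (by omega) (by omega) (by omega))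
  det_nonneg i j k hij hjk hk := h.det_nonneg s hij hjk (by omega)
  ne i j hij hj e := h.ne s hij (by omega) (toLVec_injective e)

end IsConvexHypPolygon

end

/-! ### The green-black arm lemma -/

theorem GBColor.eq_black_or_green (c : GBColor) : c = GBColor.black ∨ c = GBColor.green := by
  cases c <;> simp

theorem mainTheorem4 (k : ℕ) (P P' : GreenBlackArmChain k)
    (hPP' : P.BlackEdgeCongruent P')
    (hedge : ∀ i : Fin (k + 1), P.edgeColor i = GBColor.green → P.edgeLength i ≤ P'.edgeLength i)
    (hgreen : ∀ j : Fin k, P.IsGreenVertex j → P.angle j ≤ P'.angle j)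
    (hblack : ∀ j : Fin k, ¬ P.IsGreenVertex j → P.angle j = P'.angle j)
    (hright : ∀ j : Fin k, P.edgeColor j.succ = GBColor.green → P.angle j = Real.pi / 2) :
    P.freeDist ≤ P'.freeDist ∧
      (P.freeDist = P'.freeDist ↔
        (∀ i : Fin (k + 1), P.edgeLength i = P'.edgeLength i) ∧
          ∀ j : Fin k, P.angle j = P'.angle j) := by
  obtain ⟨hcomp, hblackEdge⟩ := hPP'
  obtain ⟨m, Q, s, hm, hv, hc⟩ := P.isSubchain
  obtain ⟨m', Q', s', hm', hv', hc'⟩ := P'.isSubchain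
  have hC := Q.convex.isConvexChain s (n := k + 1) (by omega)
  have hC' := Q'.convex.isConvexChain s' (n := k + 1) (by omega)
  set l : ℕ → ℝ := fun i => dist (Q.vertex (s + (i : ZMod m)))
    (Q.vertex (s + ((i + 1 : ℕ) : ZMod m))) with hl
  set l' : ℕ → ℝ := fun i => dist (Q'.vertex (s' + (i : ZMod m')))
    (Q'.vertex (s' + ((i + 1 : ℕ) : ZMod m'))) with hl'
  -- At `i = 0` the truncated `i - 1` gives a meaningless value; only interior vertices, with `i ≥
  -- 1`, are ever consulted.
  set a : ℕ → ℝ := fun i => Real.pi - hypAngle (Q.vertex (s + ((i - 1 : ℕ) : ZMod m)))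
    (Q.vertex (s + (i : ZMod m))) (Q.vertex (s + ((i + 1 : ℕ) : ZMod m))) with ha
  set a' : ℕ → ℝ := fun i => Real.pi - hypAngle (Q'.vertex (s' + ((i - 1 : ℕ) : ZMod m')))
    (Q'.vertex (s' + (i : ZMod m'))) (Q'.vertex (s' + ((i + 1 : ℕ) : ZMod m'))) with ha'
  have el : ∀ i : Fin (k + 1), P.edgeLength i = l i := fun i => by
    rw [GreenBlackArmChain.edgeLength, hv, hv]; rfl
  have el' : ∀ i : Fin (k + 1), P'.edgeLength i = l' i := fun i => by
    rw [GreenBlackArmChain.edgeLength, hv', hv']; rfl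
  have ea : ∀ j : Fin k, P.angle j = Real.pi - a (j + 1) := fun j => by
    rw [GreenBlackArmChain.angle, hv, hv, hv, ha]
    simp only [Fin.val_castSucc, Fin.val_succ, add_tsub_cancel_right, sub_sub_cancel]
  have ea' : ∀ j : Fin k, P'.angle j = Real.pi - a' (j + 1) := fun j => by
    rw [GreenBlackArmChain.angle, hv', hv', hv', ha']
    simp only [Fin.val_castSucc, Fin.val_succ, add_tsub_cancel_right, sub_sub_cancel]
  have hle : ∀ j : Fin k, P.angle j ≤ P'.angle j := fun j => by
    by_cases h : P.IsGreenVertex j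
    · exact hgreen j h
    · exact (hblack j h).le
  have hop : LVec.ChainOpens (k + 1) l a l' a' := by
    refine ⟨fun i _ _ => ?_, fun i h0 hi => ?_, fun i h0 hi => ?_, fun i hi => ?_, fun i hi => ?_⟩
    · exact sub_nonneg.2 (InnerProductGeometry.angle_le_pi _ _)
    · obtain ⟨i, rfl⟩ : ∃ j, i = j + 1 := ⟨i - 1, by omega⟩
      have := hle ⟨i, by omega⟩
      rw [ea, ea'] at this
      linarith
    · obtain ⟨i, rfl⟩ : ∃ j, i = j + 1 := ⟨i - 1, by omega⟩
      have h1 := Q.convex.hypAngle_ne_zero (s + (i : ZMod m))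
      have h2 : 0 ≤ hypAngle (Q.vertex (s + (i : ZMod m))) (Q.vertex (s + (i : ZMod m) + 1))
        (Q.vertex (s + (i : ZMod m) + 2)) := InnerProductGeometry.angle_nonneg _ _
      have h3 : a (i + 1) = Real.pi - hypAngle (Q.vertex (s + (i : ZMod m)))
          (Q.vertex (s + (i : ZMod m) + 1)) (Q.vertex (s + (i : ZMod m) + 2)) := by
        simp only [ha, add_tsub_cancel_right, Nat.cast_add, Nat.cast_one, add_assoc,
          one_add_one_eq_two]
      rw [h3]
      have := lt_of_le_of_ne h2 (Ne.symm h1)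
      linarith
    · have e1 := el ⟨i, hi⟩
      have e2 := el' ⟨i, hi⟩
      rcases (P.edgeColor ⟨i, hi⟩).eq_black_or_green with h | h
      · have := hblackEdge _ h
        rw [e1, e2] at this
        exact this.le
      · have := hedge _ h
        rwa [e1, e2] at this
    · have hlen : ∀ j (hj : j < k + 1), P.edgeColor ⟨j, hj⟩ = GBColor.black → l j = l' j :=
        fun j hj h => by
          have := hblackEdge _ h
          rwa [el, el'] at this
      rcases (P.edgeColor ⟨i, hi⟩).eq_black_or_green with h | h
      · exact Or.inl (hlen i hi h)
      -- The end edges are black, so a green edge has both neighbours inside the chain. These are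
      -- black, hence of fixed length, and the interior angles of at most π/2 in both polygons
      -- become turns of at least π/2.
      have h0 : i ≠ 0 := by
        rintro rfl
        have := P.first_black
        rw [Fin.zero_eta, this] at h
        cases h
      have hk : i ≠ k := by
        rintro rfl
        have := P.last_black
        rw [Fin.last, h] at this
        cases this
      have h' : P'.edgeColor ⟨i, hi⟩ = GBColor.green := by rw [← hcomp]; exact h
      have g : Q.edgeColor (s + (i : ZMod m)) = GBColor.green := by rw [← hc ⟨i, hi⟩]; exact h
      have g' : Q'.edgeColor (s' + (i : ZMod m')) = GBColor.green := by
        rw [← hc' ⟨i, hi⟩]; exact h'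
      obtain ⟨i, rfl⟩ : ∃ j, i = j + 1 := ⟨i - 1, by omega⟩
      have p : s + ((i + 1 : ℕ) : ZMod m) - 1 = s + (i : ZMod m) := by push_cast; ring
      have p' : s' + ((i + 1 : ℕ) : ZMod m') - 1 = s' + (i : ZMod m') := by push_cast; ring
      have n1 : s + ((i + 1 : ℕ) : ZMod m) + 1 = s + ((i + 1 + 1 : ℕ) : ZMod m) := by
        push_cast; ring
      have n1' : s' + ((i + 1 : ℕ) : ZMod m') + 1 = s' + ((i + 1 + 1 : ℕ) : ZMod m') := by
        push_cast; ring
      have n2 : s + ((i + 1 : ℕ) : ZMod m) + 2 = s + ((i + 1 + 1 + 1 : ℕ) : ZMod m) := by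
        push_cast; ring
      have n2' : s' + ((i + 1 : ℕ) : ZMod m') + 2 = s' + ((i + 1 + 1 + 1 : ℕ) : ZMod m') := by
        push_cast; ring
      have l1 := Q.angle_left _ g
      have r1 := Q.angle_right _ g
      have l1' := Q'.angle_left _ g'
      have r1' := Q'.angle_right _ g'
      rw [p, n1] at l1
      rw [p', n1'] at l1'
      rw [n1, n2] at r1
      rw [n1', n2'] at r1'
      have b1 := Q.prev_black _ g
      have b2 := Q.next_black _ g
      rw [p] at b1
      rw [n1] at b2
      refine Or.inr ⟨by omega, by omega, ?_, ?_, ?_, ?_, ?_, ?_⟩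
      · simp only [ha, add_tsub_cancel_right]; linarith
      · simp only [ha', add_tsub_cancel_right]; linarith
      · simp only [ha, add_tsub_cancel_right]; linarith
      · simp only [ha', add_tsub_cancel_right]; linarith
      · exact hlen i (by omega) (by rw [hc]; exact b1)
      · exact hlen (i + 1 + 1) (by omega) (by rw [hc]; exact b2)
  have hf : Real.cosh P.freeDist = LVec.bil (Q.vertex (s + ((0 : ℕ) : ZMod m))).toLVec
      (Q.vertex (s + ((k + 1 : ℕ) : ZMod m))).toLVec := by
    rw [UpperHalfPlane.bil_toLVec, GreenBlackArmChain.freeDist, hv, hv]; rfl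
  have hf' : Real.cosh P'.freeDist = LVec.bil (Q'.vertex (s' + ((0 : ℕ) : ZMod m'))).toLVec
      (Q'.vertex (s' + ((k + 1 : ℕ) : ZMod m'))).toLVec := by
    rw [UpperHalfPlane.bil_toLVec, GreenBlackArmChain.freeDist, hv', hv']; rfl
  obtain ⟨hmain, heq⟩ := hC.bil_le hC'.toIsChain hop
  rw [← hf, ← hf'] at hmain heq
  have hd : 0 ≤ P.freeDist := dist_nonneg
  have hd' : 0 ≤ P'.freeDist := dist_nonneg
  have hle' : P.freeDist ≤ P'.freeDist := by
    rwa [Real.cosh_le_cosh, abs_of_nonneg hd, abs_of_nonneg hd'] at hmain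
  refine ⟨hle', fun h => ?_, fun ⟨h1, h2⟩ => le_antisymm hle' ?_⟩
  · obtain ⟨q1, q2⟩ := heq (congrArg Real.cosh h)
    refine ⟨fun i => ?_, fun j => ?_⟩
    · rw [el, el']; exact q1 i i.2
    · rw [ea, ea', q2 (j + 1) (by omega) (by omega)]
  · have hb := hC.toIsChain.bil_eq_bil hC'.toIsChain
      (fun i hi => by rw [← el ⟨i, hi⟩, ← el' ⟨i, hi⟩]; exact h1 _)
      (fun i hi => by
        have := h2 ⟨i, hi⟩
        rw [ea, ea'] at this
        simp only at this
        linarith)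
    rw [← hf, ← hf'] at hb
    have := hb.ge
    rwa [Real.cosh_le_cosh, abs_of_nonneg hd, abs_of_nonneg hd'] at this
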